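/- Let $R$ be an associative ring with identity, $M$ an $R$-$R$-bimodule and $\theta : M\otimes_R M\to M$ a homomorphism of $R$-$R$-bimodules which is associative, i.e. $\theta(\theta(m\otimes n)\otimes p)=\theta(m\otimes\theta(n\otimes p))$ for all $m,n,p\in M$. Let $T=R\ltimes_\theta M$ be the $\theta$-extension: the ring with underlying group $R\oplus M$ and multiplication $(r,m)(r',m')=(rr',\,rm'+mr'+\theta(m\otimes m'))$. There are ring homomorphisms $R\to T$, $r\mapsto (r,0)$, and $T\to R$, $(r,m)\mapsto r$; let $e:\operatorname{Mod}T\to\operatorname{Mod}R$ be restriction of scalars along $R\to T$, and regard $R$ as a left and right $T$-module along $T\to R$. A left $T$-module is identified with a pair $(X,\alpha)$, where $X$ is a left $R$-module and $\alpha:M\otimes_R X\to X$ is an $R$-linear map with $\alpha\circ(1_M\otimes\alpha)=\alpha\circ(\theta\otimes 1_X)$; here $(r,m)x=rx+\alpha(m\otimes x)$. For a ring $A$, a complete $A$-projective resolution is an exact complex $P^\bullet$ $(\cdots\to P^{-1}\to P^0\to P^1\to\cdots)$ of (arbitrary) projective left $A$-modules such that $\operatorname{Hom}_A(P^\bullet,Q)$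 is exact for every projective left $A$-module $Q$; a left $A$-module is Gorenstein projective if it is isomorphic to $\operatorname{Im}(d^0)$ for some complete $A$-projective resolution $(P^\bullet,d^\bullet)$. For an $A$-module $W$, $\operatorname{Add}W$ is the class of modules isomorphic to direct summands of direct sums of copies of $W$. Write $M^0=R$ and $M^{j+1}=M\otimes_R M^j$. Assume the following two conditions. (1) For every complete $R$-projective resolution $P^\bullet$, the complexes $M\otimes_R P^\bullet$ and $\operatorname{Hom}_R(P^\bullet,N)$, for all $N\in\operatorname{Add}M$, are acyclic. (2) Either (a) for every complete $T$-projective resolution $Q^\bullet$, the complexes $R\otimes_T Q^\bullet$ and $\operatorname{Hom}_T(Q^\bullet,N)$, for all $N\in\operatorname{Add}({}_TR)$, are acyclic; or (b) $M$ is nilpotent (i.e. $M^n=0$ for some $n$), $\operatorname{Tor}^R_i(M^j,N)=0$ for all $i,j>0$ and all $N\in\operatorname{Add}M$, and for every complete $T$-projective resolution $Q^\bullet$ and every $j>0$ the complexes $M^j\otimes_R e(Q^\bullet)$ and $\operatorname{Hom}_T(Q^\bullet,N)$, for all $N\in\operatorname{Add}(T\otimes_R M^j)$, are acyclic. Then: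 (i) the functors $T\otimes_R-:\operatorname{Mod}R\to\operatorname{Mod}T$ and $R\otimes_T-:\operatorname{Mod}T\to\operatorname{Mod}R$ preserve Gorenstein projective modules; (ii) if a left $T$-module $(X,\alpha)$ is Gorenstein projective, then $\operatorname{Coker}\alpha$ is a Gorenstein projective $R$-module and the sequence $$M\otimes_R M\otimes_R X\xrightarrow{\;1_M\otimes\alpha-\theta\otimes 1_X\;}M\otimes_R X\xrightarrow{\;\alpha\;}X$$ is exact (at $M\otimes_R X$); (iii) if $\theta=0$, the converse of (ii) holds: if $\operatorname{Coker}\alpha$ is a Gorenstein projective $R$-module and the sequence in (ii) is exact, then $(X,\alpha)$ is a Gorenstein projective $T$-module. -/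

import Mathlib

open CategoryTheory MulOpposite
open scoped TensorProduct

universe u

noncomputable section

/-! Tensor products over a ring that need not be commutative. A right `R`-module is a module
over `Rᵐᵒᵖ`, and `op r • m` is the product `m r`. An `S`-`R`-bimodule is a left `S`-module and
right `R`-module with commuting actions. -/

/-- The subgroup of `M ⊗_ℤ X` generated by the elements `m r ⊗ x - m ⊗ r x`. -/
def balancedRelations (R : Type*) [Ring R] (M : Type*) [AddCommGroup M] [Module Rᵐᵒᵖ M]
    (X : Type*) [AddCommGroup X] [Module R X] : AddSubgroup (M ⊗[ℤ] X) :=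
  AddSubgroup.closure
    {z | ∃ (m : M) (r : R) (x : X), z = (op r • m) ⊗ₜ[ℤ] x - m ⊗ₜ[ℤ] (r • x)}

/-- The tensor product `M ⊗_R X` of a right `R`-module `M` and a left `R`-module `X`. -/
def BalTensor (R : Type*) [Ring R] (M : Type*) [AddCommGroup M] [Module Rᵐᵒᵖ M]
    (X : Type*) [AddCommGroup X] [Module R X] : Type _ :=
  (M ⊗[ℤ] X) ⧸ balancedRelations R M X

namespace BalTensor

section Basic

variable {R : Type*} [Ring R] {M : Type*} [AddCommGroup M] [Module Rᵐᵒᵖ M]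
  {X : Type*} [AddCommGroup X] [Module R X] {P : Type*} [AddCommGroup P]

instance : AddCommGroup (BalTensor R M X) :=
  inferInstanceAs (AddCommGroup ((M ⊗[ℤ] X) ⧸ balancedRelations R M X))

variable (R M X) in
/-- The quotient map `M ⊗_ℤ X → M ⊗_R X`. -/
def quot : (M ⊗[ℤ] X) →+ BalTensor R M X :=
  QuotientAddGroup.mk' (balancedRelations R M X)

variable (R) in
/-- The pure tensor `m ⊗ x`. -/
def tmul (m : M) (x : X) : BalTensor R M X := quot R M X (m ⊗ₜ[ℤ] x)

theorem add_tmul (m m' : M) (x : X) : tmul R (m + m') x = tmul R m x + tmul R m' x := by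
  simp only [tmul, TensorProduct.add_tmul, map_add]

theorem tmul_add (m : M) (x x' : X) : tmul R m (x + x') = tmul R m x + tmul R m x' := by
  simp only [tmul, TensorProduct.tmul_add, map_add]

theorem zero_tmul (x : X) : tmul R (0 : M) x = 0 := by
  simp only [tmul, TensorProduct.zero_tmul, map_zero]

theorem tmul_zero (m : M) : tmul R m (0 : X) = 0 := by
  simp only [tmul, TensorProduct.tmul_zero, map_zero]

theorem op_smul_tmul (m : M) (r : R) (x : X) : tmul R (op r • m) x = tmul R m (r • x) := by
  rw [← sub_eq_zero, tmul, tmul, ← map_sub]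
  exact (QuotientAddGroup.eq_zero_iff _).2 (AddSubgroup.subset_closure ⟨m, r, x, rfl⟩)

@[elab_as_elim]
theorem induction_on {motive : BalTensor R M X → Prop} (z : BalTensor R M X)
    (zero : motive 0) (tmul : ∀ m x, motive (tmul R m x))
    (add : ∀ a b, motive a → motive b → motive (a + b)) : motive z := by
  obtain ⟨w, rfl⟩ : ∃ w, quot R M X w = z :=
    QuotientAddGroup.mk'_surjective (balancedRelations R M X) z
  induction w using TensorProduct.induction_on with
  | zero => simpa only [map_zero] using zero
  | tmul m x => exact tmul m x
  | add a b ha hb => simpa only [map_add] using add _ _ ha hb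

/-- A biadditive map that is balanced over `R` factors through `M ⊗_R X`. -/
def lift (f : M →+ X →+ P) (hf : ∀ (m : M) (r : R) (x : X), f (op r • m) x = f m (r • x)) :
    BalTensor R M X →+ P :=
  QuotientAddGroup.lift (balancedRelations R M X)
    (TensorProduct.liftAddHom f fun n m x => by simp) <| by
      rw [balancedRelations, AddSubgroup.closure_le]
      rintro _ ⟨m, r, x, rfl⟩
      simp [hf]

@[simp]
theorem lift_tmul (f : M →+ X →+ P)
    (hf : ∀ (m : M) (r : R) (x : X), f (op r • m) x = f m (r • x)) (m : M) (x : X) :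
    lift f hf (tmul R m x) = f m x := rfl

/-- The biadditive map `(m, x) ↦ m ⊗ x`. -/
def mk : M →+ X →+ BalTensor R M X where
  toFun m := { toFun := tmul R m, map_zero' := tmul_zero m, map_add' := tmul_add m }
  map_zero' := by ext x; exact zero_tmul x
  map_add' m m' := by ext x; exact add_tmul m m' x

@[simp]
theorem mk_apply (m : M) (x : X) : mk m x = tmul R m x := rfl

end Basic

section LeftAction

variable {S : Type*} [Ring S] {R : Type*} [Ring R] {M : Type*} [AddCommGroup M] [Module S M]
  [Module Rᵐᵒᵖ M] [SMulCommClass S Rᵐᵒᵖ M] {X : Type*} [AddCommGroup X] [Module R X]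

/-- The left action `s (m ⊗ x) = (s m) ⊗ x`. -/
def smulLeft (s : S) : BalTensor R M X →+ BalTensor R M X :=
  lift (mk.comp (DistribSMul.toAddMonoidHom M s)) fun m r x => by
    simp [smul_comm s (op r) m, op_smul_tmul]

instance : SMul S (BalTensor R M X) := ⟨fun s z => smulLeft s z⟩

@[simp]
theorem smul_tmul (s : S) (m : M) (x : X) : s • tmul R m x = tmul R (s • m) x := rfl

instance : DistribSMul S (BalTensor R M X) where
  smul_zero s := map_zero (smulLeft s)
  smul_add s := map_add (smulLeft s)

instance : Module S (BalTensor R M X) where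
  one_smul z := by
    induction z using induction_on with
    | zero => exact smul_zero _
    | tmul m x => simp
    | add a b ha hb => rw [smul_add, ha, hb]
  mul_smul s t z := by
    induction z using induction_on with
    | zero => simp only [smul_zero]
    | tmul m x => simp [mul_smul]
    | add a b ha hb => simp only [smul_add, ha, hb]
  smul_zero := smul_zero
  smul_add := smul_add
  add_smul s t z := by
    induction z using induction_on with
    | zero => simp only [smul_zero, add_zero]
    | tmul m x => simp [add_smul, add_tmul]
    | add a b ha hb => simp only [smul_add, ha, hb]; abel
  zero_smul z := by
    induction z using induction_on with
    | zero => exact smul_zero _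
    | tmul m x => simp [zero_tmul]
    | add a b ha hb => rw [smul_add, ha, hb, add_zero]

end LeftAction

section RightAction

variable {Q : Type*} [Ring Q] {R : Type*} [Ring R] {M : Type*} [AddCommGroup M]
  [Module Rᵐᵒᵖ M] {X : Type*} [AddCommGroup X] [Module R X] [Module Qᵐᵒᵖ X]
  [SMulCommClass R Qᵐᵒᵖ X]

/-- The right action `(m ⊗ x) q = m ⊗ (x q)`. -/
def smulRight (q : Qᵐᵒᵖ) : BalTensor R M X →+ BalTensor R M X :=
  lift ((AddMonoidHom.compHom' (DistribSMul.toAddMonoidHom X q)).comp mk) fun m r x => by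
    simp [smul_comm r q x, op_smul_tmul]

instance : SMul Qᵐᵒᵖ (BalTensor R M X) := ⟨fun q z => smulRight q z⟩

@[simp]
theorem op_smul_tmul_right (q : Qᵐᵒᵖ) (m : M) (x : X) :
    q • tmul R m x = tmul R m (q • x) := rfl

instance : DistribSMul Qᵐᵒᵖ (BalTensor R M X) where
  smul_zero q := map_zero (smulRight q)
  smul_add q := map_add (smulRight q)

instance : Module Qᵐᵒᵖ (BalTensor R M X) where
  one_smul z := by
    induction z using induction_on with
    | zero => exact smul_zero _
    | tmul m x => simp
    | add a b ha hb => rw [smul_add, ha, hb]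
  mul_smul s t z := by
    induction z using induction_on with
    | zero => simp only [smul_zero]
    | tmul m x => simp [mul_smul]
    | add a b ha hb => simp only [smul_add, ha, hb]
  smul_zero := smul_zero
  smul_add := smul_add
  add_smul s t z := by
    induction z using induction_on with
    | zero => simp only [smul_zero, add_zero]
    | tmul m x => simp [add_smul, tmul_add]
    | add a b ha hb => simp only [smul_add, ha, hb]; abel
  zero_smul z := by
    induction z using induction_on with
    | zero => exact smul_zero _
    | tmul m x => simp [tmul_zero]
    | add a b ha hb => rw [smul_add, ha, hb, add_zero]

instance {S : Type*} [Ring S] [Module S M] [SMulCommClass S Rᵐᵒᵖ M] :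
    SMulCommClass S Qᵐᵒᵖ (BalTensor R M X) where
  smul_comm s q z := by
    induction z using induction_on with
    | zero => simp only [smul_zero]
    | tmul m x => simp
    | add a b ha hb => simp only [smul_add, ha, hb]

end RightAction

section Maps

variable {S : Type*} [Ring S] {R : Type*} [Ring R]
  {M : Type*} [AddCommGroup M] [Module S M] [Module Rᵐᵒᵖ M] [SMulCommClass S Rᵐᵒᵖ M]
  {N : Type*} [AddCommGroup N] [Module S N] [Module Rᵐᵒᵖ N] [SMulCommClass S Rᵐᵒᵖ N]
  {X : Type*} [AddCommGroup X] [Module R X] {Y : Type*} [AddCommGroup Y] [Module R Y]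

variable (S M) in
/-- The map `1_M ⊗ f : M ⊗_R X → M ⊗_R Y`, as a map of left `S`-modules. -/
def lTensor (f : X →ₗ[R] Y) : BalTensor R M X →ₗ[S] BalTensor R M Y where
  toFun := lift ((AddMonoidHom.compHom' f.toAddMonoidHom).comp mk) fun m r x => by
    simp [op_smul_tmul]
  map_add' := map_add _
  map_smul' s z := by
    induction z using induction_on with
    | zero => simp only [smul_zero, map_zero]
    | tmul m x => simp
    | add a b ha hb => simp only [smul_add, map_add, ha, hb]

@[simp]
theorem lTensor_tmul (f : X →ₗ[R] Y) (m : M) (x : X) :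
    lTensor S M f (tmul R m x) = tmul R m (f x) := rfl

theorem lTensor_add (f g : X →ₗ[R] Y) :
    lTensor S M (f + g) = lTensor S M f + lTensor S M g := by
  ext z
  induction z using induction_on with
  | zero => simp only [map_zero]
  | tmul m x => exact tmul_add m (f x) (g x)
  | add a b ha hb => rw [map_add, map_add, ha, hb]

variable (X) in
/-- The map `g ⊗ 1_X : M ⊗_R X → N ⊗_R X`, for a map of bimodules `g : M → N`. -/
def rTensor (g : M →ₗ[S] N) (hg : ∀ (r : Rᵐᵒᵖ) (m : M), g (r • m) = r • g m) :
    BalTensor R M X →ₗ[S] BalTensor R N X where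
  toFun := lift (mk.comp g.toAddMonoidHom) fun m r x => by simp [hg, op_smul_tmul]
  map_add' := map_add _
  map_smul' s z := by
    induction z using induction_on with
    | zero => simp only [smul_zero, map_zero]
    | tmul m x =>
      change tmul R (g (s • m)) x = tmul R (s • g m) x
      rw [map_smul]
    | add a b ha hb => simp only [smul_add, map_add, ha, hb]

@[simp]
theorem rTensor_tmul (g : M →ₗ[S] N) (hg : ∀ (r : Rᵐᵒᵖ) (m : M), g (r • m) = r • g m)
    (m : M) (x : X) : rTensor X g hg (tmul R m x) = tmul R (g m) x := rfl

variable {Q : Type*} [Ring Q] {L : Type*} [AddCommGroup L] [Module R L] [Module Qᵐᵒᵖ L]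
  [SMulCommClass R Qᵐᵒᵖ L] {Z : Type*} [AddCommGroup Z] [Module Q Z]

/-- For fixed `m`, the map `n ⊗ z ↦ (m ⊗ n) ⊗ z`. -/
def assocAux (m : M) : BalTensor Q L Z →+ BalTensor Q (BalTensor R M L) Z :=
  lift (mk.comp (mk (R := R) m)) fun n q z => by
    simp [← op_smul_tmul, ← op_smul_tmul_right]

@[simp]
theorem assocAux_tmul (m : M) (n : L) (z : Z) :
    assocAux m (tmul Q n z) = tmul Q (tmul R m n) z := rfl

variable (S R M Q L Z) in
/-- The associativity map `m ⊗ (n ⊗ z) ↦ (m ⊗ n) ⊗ z`. -/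
def assocInv : BalTensor R M (BalTensor Q L Z) →ₗ[S] BalTensor Q (BalTensor R M L) Z where
  toFun := lift
    { toFun := assocAux
      map_zero' := by
        ext w
        induction w using induction_on with
        | zero => simp only [map_zero]
        | tmul n z => simp [zero_tmul]
        | add a b ha hb => rw [map_add, map_add, ha, hb]
      map_add' := fun m m' => by
        ext w
        induction w using induction_on with
        | zero => simp only [map_zero]
        | tmul n z => simp [add_tmul]
        | add a b ha hb => rw [map_add, map_add, ha, hb] }
    fun m r w => by
      change assocAux (op r • m) w = assocAux m (r • w)
      induction w using induction_on with
      | zero => simp only [smul_zero, map_zero]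
      | tmul n z => simp [op_smul_tmul]
      | add a b ha hb => rw [smul_add, map_add, map_add, ha, hb]
  map_add' := map_add _
  map_smul' s w := by
    induction w using induction_on with
    | zero => simp only [smul_zero, map_zero]
    | add a b ha hb => simp only [smul_add, map_add, ha, hb]
    | tmul m v =>
      change assocAux (s • m) v = s • assocAux m v
      induction v using induction_on with
      | zero => simp only [smul_zero, map_zero]
      | tmul n z => simp
      | add a b ha hb => rw [map_add, map_add, smul_add, ha, hb]

@[simp]
theorem assocInv_tmul (m : M) (n : L) (z : Z) :
    assocInv S R M Q L Z (tmul R m (tmul Q n z)) = tmul Q (tmul R m n) z := rfl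

end Maps

end BalTensor

open BalTensor

/-- The functor `M ⊗_R - : Mod R ⥤ Mod S` for an `S`-`R`-bimodule `M`. -/
def tensorFunctor (S R : Type u) [Ring S] [Ring R] (M : Type u) [AddCommGroup M] [Module S M]
    [Module Rᵐᵒᵖ M] [SMulCommClass S Rᵐᵒᵖ M] : ModuleCat.{u} R ⥤ ModuleCat.{u} S where
  obj X := ModuleCat.of S (BalTensor R M X)
  map f := ModuleCat.ofHom (lTensor S M f.hom)
  map_id X := by
    ext z
    induction z using induction_on with
    | zero => simp only [map_zero]
    | tmul m x => rfl
    | add a b ha hb => simp only [map_add, ha, hb]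
  map_comp f g := by
    ext z
    induction z using induction_on with
    | zero => simp only [map_zero]
    | tmul m x => rfl
    | add a b ha hb => simp only [map_add, ha, hb]

instance (S R : Type u) [Ring S] [Ring R] (M : Type u) [AddCommGroup M] [Module S M]
    [Module Rᵐᵒᵖ M] [SMulCommClass S Rᵐᵒᵖ M] : (tensorFunctor S R M).Additive where
  map_add {_ _ f g} := ModuleCat.hom_ext (lTensor_add f.hom g.hom)

/-- An `R`-`R`-bimodule, bundled. -/
structure SelfBimodule (R : Type u) [Ring R] where
  carrier : Type u
  [addCommGroup : AddCommGroup carrier]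
  [leftModule : Module R carrier]
  [rightModule : Module Rᵐᵒᵖ carrier]
  [smulComm : SMulCommClass R Rᵐᵒᵖ carrier]

attribute [instance] SelfBimodule.addCommGroup SelfBimodule.leftModule
  SelfBimodule.rightModule SelfBimodule.smulComm

/-- The tensor powers of a bimodule: `M ^ 0 = R` and `M ^ (j + 1) = M ⊗_R M ^ j`. -/
def tensorPow (R : Type u) [Ring R] (M : Type u) [AddCommGroup M] [Module R M]
    [Module Rᵐᵒᵖ M] [SMulCommClass R Rᵐᵒᵖ M] : ℕ → SelfBimodule R
  | 0 => ⟨R⟩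
  | j + 1 => ⟨BalTensor R M (tensorPow R M j).carrier⟩

section Gorenstein

variable {C : Type*} [Category C] [Abelian C]

/-- The complex `Hom(P, N)` is exact: every `f : P ^ i ⟶ N` that vanishes on the image of
`P ^ (i - 1)` extends along `P ^ i ⟶ P ^ (i + 1)`. -/
def HomAcyclic (P : CochainComplex C ℤ) (N : C) : Prop :=
  ∀ (i : ℤ) (f : P.X i ⟶ N), P.d (i - 1) i ≫ f = 0 →
    ∃ g : P.X (i + 1) ⟶ N, P.d i (i + 1) ≫ g = f

/-- Complete projective resolutions in an abelian category. -/
structure IsCompleteProjectiveResolution (P : CochainComplex C ℤ) : Prop where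
  projective : ∀ i, Projective (P.X i)
  acyclic : P.Acyclic
  hom_acyclic : ∀ N : C, Projective N → HomAcyclic P N

/-- `G` is Gorenstein projective: it is the image of the zeroth differential of a complete
projective resolution. -/
def IsGorensteinProjective (G : C) : Prop :=
  ∃ P : CochainComplex C ℤ, IsCompleteProjectiveResolution P ∧
    Nonempty (G ≅ Limits.image (P.d 0 1))

end Gorenstein

/-- `N` belongs to `Add W`: it is isomorphic to a direct summand of a direct sum of copies
of `W`. -/
def MemAdd {A : Type u} [Ring A] (W N : ModuleCat.{u} A) : Prop :=
  ∃ (ι : Type u) (Z : ModuleCat.{u} A), Nonempty ((N × Z) ≃ₗ[A] (ι →₀ W))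

/-- An associative homomorphism of `R`-`R`-bimodules `θ : M ⊗_R M → M`. -/
structure AssocBimoduleHom (R : Type u) [Ring R] (M : Type u) [AddCommGroup M] [Module R M]
    [Module Rᵐᵒᵖ M] [SMulCommClass R Rᵐᵒᵖ M] where
  toLinearMap : BalTensor R M M →ₗ[R] M
  map_op_smul : ∀ (r : Rᵐᵒᵖ) (z : BalTensor R M M), toLinearMap (r • z) = r • toLinearMap z
  assoc : ∀ m n p : M, toLinearMap (tmul R (toLinearMap (tmul R m n)) p) =
    toLinearMap (tmul R m (toLinearMap (tmul R n p)))

namespace AssocBimoduleHom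

variable {R : Type u} [Ring R] {M : Type u} [AddCommGroup M] [Module R M] [Module Rᵐᵒᵖ M]
  [SMulCommClass R Rᵐᵒᵖ M] (θ : AssocBimoduleHom R M)

/-- The underlying group `R ⊕ M` of the `θ`-extension of `R` by `M`. -/
@[ext]
structure Ext (θ : AssocBimoduleHom R M) : Type u where
  fst : R
  snd : M

namespace Ext

variable {θ}

/-- The identification of the underlying set with `R × M`. -/
def equivProd : θ.Ext ≃ R × M where
  toFun t := (t.fst, t.snd)
  invFun p := ⟨p.1, p.2⟩

instance : AddCommGroup θ.Ext := equivProd.addCommGroup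

/-- The multiplication `(r, m) (r', m') = (r r', r m' + m r' + θ (m ⊗ m'))`. -/
instance : Mul θ.Ext :=
  ⟨fun s t => ⟨s.fst * t.fst,
    s.fst • t.snd + op t.fst • s.snd + θ.toLinearMap (tmul R s.snd t.snd)⟩⟩

instance : One θ.Ext := ⟨⟨1, 0⟩⟩

@[simp] theorem add_fst (s t : θ.Ext) : (s + t).fst = s.fst + t.fst := rfl
@[simp] theorem add_snd (s t : θ.Ext) : (s + t).snd = s.snd + t.snd := rfl
@[simp] theorem zero_fst : (0 : θ.Ext).fst = 0 := rfl
@[simp] theorem zero_snd : (0 : θ.Ext).snd = 0 := rfl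
@[simp] theorem one_fst : (1 : θ.Ext).fst = 1 := rfl
@[simp] theorem one_snd : (1 : θ.Ext).snd = 0 := rfl
@[simp] theorem mul_fst (s t : θ.Ext) : (s * t).fst = s.fst * t.fst := rfl
@[simp] theorem mul_snd (s t : θ.Ext) : (s * t).snd =
    s.fst • t.snd + op t.fst • s.snd + θ.toLinearMap (tmul R s.snd t.snd) := rfl

/-- The `θ`-extension `R ⋉_θ M`. -/
instance : Ring θ.Ext where
  __ := (inferInstance : AddCommGroup θ.Ext)
  mul := (· * ·)
  one := 1
  left_distrib a b c := by
    ext <;> simp [mul_add, smul_add, add_smul, tmul_add]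
    abel
  right_distrib a b c := by
    ext <;> simp [add_mul, smul_add, add_smul, add_tmul]
    abel
  zero_mul a := by ext <;> simp [zero_tmul]
  mul_zero a := by ext <;> simp [tmul_zero]
  mul_assoc a b c := by
    ext
    · simp [mul_assoc]
    · have h1 : θ.toLinearMap (tmul R (a.fst • b.snd) c.snd) =
          a.fst • θ.toLinearMap (tmul R b.snd c.snd) := by rw [← smul_tmul, map_smul]
      have h2 : θ.toLinearMap (tmul R a.snd (op c.fst • b.snd)) =
          op c.fst • θ.toLinearMap (tmul R a.snd b.snd) := by
        rw [← op_smul_tmul_right, θ.map_op_smul]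
      simp [mul_smul, smul_add, add_tmul, tmul_add, h1, h2, θ.assoc, op_smul_tmul,
        smul_comm a.fst (op c.fst) b.snd]
      abel
  one_mul a := by ext <;> simp [zero_tmul]
  mul_one a := by ext <;> simp [tmul_zero]

end Ext

/-- The ring homomorphism `R → T`, `r ↦ (r, 0)`. -/
def incl : R →+* θ.Ext where
  toFun r := ⟨r, 0⟩
  map_one' := rfl
  map_zero' := rfl
  map_add' r s := by ext <;> simp
  map_mul' r s := by ext <;> simp [zero_tmul]

/-- The ring homomorphism `T → R`, `(r, m) ↦ r`. -/
def proj : θ.Ext →+* R where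
  toFun := Ext.fst
  map_one' := rfl
  map_zero' := rfl
  map_add' _ _ := rfl
  map_mul' _ _ := rfl

/-- `T` as a right `R`-module along `R → T`. -/
instance : Module Rᵐᵒᵖ θ.Ext := Module.compHom θ.Ext (RingHom.op θ.incl)

instance : SMulCommClass θ.Ext Rᵐᵒᵖ θ.Ext where
  smul_comm s r t := (mul_assoc s t (θ.incl r.unop)).symm

/-- `R` as a right `T`-module along `T → R`. -/
instance : Module (θ.Ext)ᵐᵒᵖ R := Module.compHom R (RingHom.op θ.proj)

instance : SMulCommClass R (θ.Ext)ᵐᵒᵖ R where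
  smul_comm s t r := (mul_assoc s r (θ.proj t.unop)).symm

/-- The functor `l = T ⊗_R - : Mod R ⥤ Mod T`. -/
abbrev l : ModuleCat.{u} R ⥤ ModuleCat.{u} θ.Ext := tensorFunctor θ.Ext R θ.Ext

/-- The functor `q = R ⊗_T - : Mod T ⥤ Mod R`. -/
abbrev q : ModuleCat.{u} θ.Ext ⥤ ModuleCat.{u} R := tensorFunctor R θ.Ext R

/-- The functor `e : Mod T ⥤ Mod R`, restriction of scalars along `R → T`. -/
abbrev e : ModuleCat.{u} θ.Ext ⥤ ModuleCat.{u} R := ModuleCat.restrictScalars θ.incl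

/-- `R` as a left `T`-module along `T → R`. -/
abbrev baseModule : ModuleCat.{u} θ.Ext :=
  (ModuleCat.restrictScalars θ.proj).obj (ModuleCat.of R R)

/-- For every complete `R`-projective resolution `P`, the complexes `M ⊗_R P` and `Hom_R(P, N)`,
for `N` in `Add M`, are acyclic. -/
def BaseAcyclicity (_θ : AssocBimoduleHom R M) : Prop :=
  ∀ P : CochainComplex (ModuleCat.{u} R) ℤ, IsCompleteProjectiveResolution P →
    (((tensorFunctor R R M).mapHomologicalComplex _).obj P).Acyclic ∧
    ∀ N, MemAdd (ModuleCat.of R M) N → HomAcyclic P N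

/-- For every complete `T`-projective resolution `Q`, the complexes `R ⊗_T Q` and `Hom_T(Q, N)`,
for `N` in `Add R`, are acyclic. -/
def ExtAcyclicity : Prop :=
  ∀ Q : CochainComplex (ModuleCat.{u} θ.Ext) ℤ, IsCompleteProjectiveResolution Q →
    ((θ.q.mapHomologicalComplex _).obj Q).Acyclic ∧
    ∀ N, MemAdd θ.baseModule N → HomAcyclic Q N

/-- `M` is nilpotent, `Tor_i^R(M ^ j, N) = 0` for `i, j > 0` and `N` in `Add M`, and for every
complete `T`-projective resolution `Q` and `j > 0` the complexes `M ^ j ⊗_R e(Q)` and `Hom_T(Q, N)`,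
for `N` in `Add (T ⊗_R M ^ j)`, are acyclic. -/
def NilpotentAcyclicity : Prop :=
  (∃ n : ℕ, Subsingleton (tensorPow R M n).carrier) ∧
  (∀ i j : ℕ, 0 < i → 0 < j → ∀ N, MemAdd (ModuleCat.of R M) N →
    Limits.IsZero (((tensorFunctor R R (tensorPow R M j).carrier).leftDerived i).obj N)) ∧
  ∀ Q : CochainComplex (ModuleCat.{u} θ.Ext) ℤ, IsCompleteProjectiveResolution Q →
    ∀ j : ℕ, 0 < j →
      (((θ.e ⋙ tensorFunctor R R (tensorPow R M j).carrier).mapHomologicalComplex _).obj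
        Q).Acyclic ∧
      ∀ N, MemAdd (θ.l.obj (ModuleCat.of R (tensorPow R M j).carrier)) N → HomAcyclic Q N

section Pairs

variable (X : Type u) [AddCommGroup X] [Module R X]

/-- The map `θ ⊗ 1_X : M ⊗_R M ⊗_R X → M ⊗_R X`, `m ⊗ n ⊗ x ↦ θ (m ⊗ n) ⊗ x`. -/
def tensorId : BalTensor R M (BalTensor R M X) →ₗ[R] BalTensor R M X :=
  rTensor X θ.toLinearMap θ.map_op_smul ∘ₗ assocInv R R M R M X

variable {X}

/-- The condition `α ∘ (1_M ⊗ α) = α ∘ (θ ⊗ 1_X)` on an `R`-linear map `α : M ⊗_R X → X`. -/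
def IsAction (α : BalTensor R M X →ₗ[R] X) : Prop :=
  α ∘ₗ lTensor R M α = α ∘ₗ θ.tensorId X

/-- The left `T`-module `(X, α)`: the group `X` with `(r, m) x = r x + α (m ⊗ x)`. -/
def pairModule (α : BalTensor R M X →ₗ[R] X) (hα : θ.IsAction α) : ModuleCat.{u} θ.Ext :=
  letI : Module θ.Ext X :=
    { smul := fun t x => t.fst • x + α (tmul R t.snd x)
      one_smul := fun x => by
        change (1 : R) • x + α (tmul R (0 : M) x) = x
        simp [zero_tmul]
      mul_smul := fun s t x => by
        change (s.fst * t.fst) • x + α (tmul R (s.fst • t.snd + op t.fst • s.snd +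
            θ.toLinearMap (tmul R s.snd t.snd)) x) =
          s.fst • (t.fst • x + α (tmul R t.snd x)) +
            α (tmul R s.snd (t.fst • x + α (tmul R t.snd x)))
        have h : α (tmul R s.snd (α (tmul R t.snd x))) =
            α (tmul R (θ.toLinearMap (tmul R s.snd t.snd)) x) :=
          LinearMap.congr_fun hα (tmul R s.snd (tmul R t.snd x))
        simp only [add_tmul, tmul_add, map_add, smul_add, h, mul_smul, op_smul_tmul,
          ← smul_tmul, map_smul]
        abel
      smul_zero := fun t => by
        change t.fst • (0 : X) + α (tmul R t.snd (0 : X)) = 0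
        simp [tmul_zero]
      smul_add := fun t x y => by
        change t.fst • (x + y) + α (tmul R t.snd (x + y)) =
          (t.fst • x + α (tmul R t.snd x)) + (t.fst • y + α (tmul R t.snd y))
        simp only [tmul_add, map_add, smul_add]
        abel
      add_smul := fun s t x => by
        change (s.fst + t.fst) • x + α (tmul R (s.snd + t.snd) x) =
          (s.fst • x + α (tmul R s.snd x)) + (t.fst • x + α (tmul R t.snd x))
        simp only [add_tmul, map_add, add_smul]
        abel
      zero_smul := fun x => by
        change (0 : R) • x + α (tmul R (0 : M) x) = 0
        simp [zero_tmul] }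
  ModuleCat.of θ.Ext X

end Pairs

end AssocBimoduleHom

end

/-! Write T for the extension. Both functors in (i) are extensions of scalars, along R → T and T →
R, so they preserve projectives and have the restrictions as right adjoints. It remains to check, on
a complete resolution, acyclicity of the tensored complex and of its Hom complexes. Every projective
is a retract of a free module, so only free targets matter.

For T ⊗_R P: as a complex of groups it is P ⊕ (M ⊗_R P). By adjunction its maps to a free T-module
are maps from P to an extension of copies of R by copies of M. Condition (1) covers both
(`BaseAcyclicity.l_complete`).

For R ⊗_T Q: under (2a) both checks are hypotheses, after adjunction. Under (2b) they are inductions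
on the nilpotency of M. The kernel of T ⊗_R Z → Z is M ⊗_R Z, with the negative of the bar map 1 ⊗ α
- θ ⊗ 1 as its action. Dimension shifting along these sequences ends at M^n = 0 and gives the Hom
condition (`NilpotentAcyclicity.homAcyclic_of_equiv`). For acyclicity, R ⊗_T Z is the cokernel of
the action on Z. When Z is projective, M ⊗ M ⊗ Z → M ⊗ Z → Z is contractible in the middle, and the
contraction is inherited by M ⊗ Z, so a diagram chase passes from M ⊗ Q to Q
(`exists_eq_d_add_action`).

Part (ii): Coker α is R ⊗_T X, hence Gorenstein projective by (i). Exactness at M ⊗ X holds for the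
projective Q^0 by contractibility and descends to X through Q^{-1} → Q^0 → X, because R ⊗_T Q is
acyclic (`exact_barMap_of_presentation`).

Part (iii): take a complete resolution P of Coker α and look for a resolution of X of the form T ⊗_R
P with a lower triangular differential, with d and 1 ⊗ d on the diagonal and a cocycle P^i → M ⊗
P^{i+1} off it. The extension of Coker α by M ⊗ Coker α that makes up X determines the cocycle in
one degree. Condition (1) extends it to all degrees (`exists_cocycle`), and any such twist is again
a complete resolution (`twistedComplex_complete`). -/

noncomputable section

/-! ### Acyclicity of Hom complexes -/

section HomAcyclic

variable {C : Type*} [Category C] [Abelian C]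

/-- With the neighbouring degrees as free variables, no transport along `j - 1 + 1 = j` is needed.
-/
theorem homAcyclic_iff {P : CochainComplex C ℤ} {N : C} : HomAcyclic P N ↔
    ∀ i j k : ℤ, i + 1 = j → j + 1 = k → ∀ f : P.X j ⟶ N, P.d i j ≫ f = 0 →
      ∃ g : P.X k ⟶ N, P.d j k ≫ g = f := by
  refine ⟨fun h i j k hi hk f hf => ?_, fun h i => h _ _ _ (by lia) rfl⟩
  obtain rfl : i = j - 1 := by lia
  subst hk
  exact h j f hf

theorem HomAcyclic.of_retract {P : CochainComplex C ℤ} {N N' : C} (h : HomAcyclic P N)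
    (r : Retract N' N) : HomAcyclic P N' := fun i f hf => by
  obtain ⟨g, hg⟩ := h i (f ≫ r.i) (by rw [reassoc_of% hf, Limits.zero_comp])
  exact ⟨g ≫ r.r, by rw [reassoc_of% hg, r.retract, Category.comp_id]⟩

theorem HomAcyclic.of_iso {P : CochainComplex C ℤ} {N N' : C} (h : HomAcyclic P N)
    (e : N ≅ N') : HomAcyclic P N' :=
  h.of_retract ⟨e.inv, e.hom, e.inv_hom_id⟩

/-- A map extending f modulo S.X₁ lifts to S.X₂ because the terms of P are projective; the error is
a cocycle with values in S.X₁. -/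
theorem HomAcyclic.of_shortExact_mid {P : CochainComplex C ℤ} [∀ i, Projective (P.X i)]
    {S : ShortComplex C} (hS : S.ShortExact) (h₁ : HomAcyclic P S.X₁)
    (h₃ : HomAcyclic P S.X₃) : HomAcyclic P S.X₂ := by
  have := hS.mono_f
  have := hS.epi_g
  intro i f hf
  obtain ⟨g, hg⟩ := h₃ i (f ≫ S.g) (by rw [reassoc_of% hf, Limits.zero_comp])
  let g' := Projective.factorThru g S.g
  have hg' : g' ≫ S.g = g := Projective.factorThru_comp _ _
  have hk : (f - P.d i (i + 1) ≫ g') ≫ S.g = 0 := by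
    rw [Preadditive.sub_comp, Category.assoc, hg', hg, sub_self]
  obtain ⟨b, hb⟩ := h₁ i (hS.exact.lift _ hk) (by
    rw [← cancel_mono S.f, Category.assoc, hS.exact.lift_f, Preadditive.comp_sub, hf]
    simp)
  refine ⟨g' + b ≫ S.f, ?_⟩
  rw [Preadditive.comp_add, reassoc_of% hb, hS.exact.lift_f]
  abel

/-- A lift f' of f to S.X₂ need not be a cocycle. Its coboundary is a cocycle in S.X₁ one degree
lower, hence extends there, and subtracting the extension corrects f'. -/
theorem HomAcyclic.of_shortExact_right {P : CochainComplex C ℤ} [∀ i, Projective (P.X i)]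
    {S : ShortComplex C} (hS : S.ShortExact) (h₁ : HomAcyclic P S.X₁)
    (h₂ : HomAcyclic P S.X₂) : HomAcyclic P S.X₃ := by
  have := hS.mono_f
  have := hS.epi_g
  rw [homAcyclic_iff] at h₁ h₂ ⊢
  intro i j k hi hk f hf
  let f' := Projective.factorThru f S.g
  have hf' : f' ≫ S.g = f := Projective.factorThru_comp _ _
  have ha : (P.d i j ≫ f') ≫ S.g = 0 := by rw [Category.assoc, hf', hf]
  obtain ⟨b, hb⟩ := h₁ (i - 1) i j (by lia) hi (hS.exact.lift _ ha) (by
    rw [← cancel_mono S.f, Category.assoc, hS.exact.lift_f]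
    simp)
  obtain ⟨g, hg⟩ := h₂ i j k hi hk (f' - b ≫ S.f) (by
    rw [Preadditive.comp_sub, reassoc_of% hb, hS.exact.lift_f, sub_self])
  refine ⟨g ≫ S.g, ?_⟩
  rw [reassoc_of% hg, Preadditive.sub_comp, hf', Category.assoc, S.zero, Limits.comp_zero,
    sub_zero]

theorem homAcyclic_iff_of_adjunction {D : Type*} [Category D] [Abelian D] {F : C ⥤ D}
    {G : D ⥤ C} [F.Additive] (adj : F ⊣ G) (P : CochainComplex C ℤ) (N : D) :
    HomAcyclic ((F.mapHomologicalComplex _).obj P) N ↔ HomAcyclic P (G.obj N) := by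
  -- G is not assumed additive, so that transposition respects zero comes from naturality and the
  -- additivity of F.
  have hz {X : C} (f : F.obj X ⟶ N) : f = 0 ↔ adj.homEquiv X N f = 0 := by
    have h0 : adj.homEquiv X N 0 = 0 := by
      simpa only [Functor.map_zero, Limits.zero_comp] using
        adj.homEquiv_naturality_left (0 : X ⟶ X) (0 : F.obj X ⟶ N)
    rw [← h0, EmbeddingLike.apply_eq_iff_eq]
  have key : HomAcyclic ((F.mapHomologicalComplex _).obj P) N ↔
      ∀ (i : ℤ) (f : F.obj (P.X i) ⟶ N), F.map (P.d (i - 1) i) ≫ f = 0 →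
        ∃ g : F.obj (P.X (i + 1)) ⟶ N, F.map (P.d i (i + 1)) ≫ g = f := Iff.rfl
  rw [key]
  constructor
  · intro h i f hf
    obtain ⟨g, hg⟩ := h i ((adj.homEquiv _ _).symm f) (by
      rw [hz, adj.homEquiv_naturality_left, Equiv.apply_symm_apply, hf])
    refine ⟨adj.homEquiv _ _ g, ?_⟩
    rw [← adj.homEquiv_naturality_left, hg, Equiv.apply_symm_apply]
  · intro h i f hf
    obtain ⟨g, hg⟩ := h i (adj.homEquiv _ _ f) (by
      rw [← adj.homEquiv_naturality_left, ← hz, hf])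
    refine ⟨(adj.homEquiv _ _).symm g, ?_⟩
    rw [← adj.homEquiv_naturality_left_symm, hg, Equiv.symm_apply_apply]

theorem IsGorensteinProjective.of_iso {G G' : C} (h : IsGorensteinProjective G) (e : G ≅ G') :
    IsGorensteinProjective G' := by
  obtain ⟨P, hP, ⟨i⟩⟩ := h
  exact ⟨P, hP, ⟨e.symm ≪≫ i⟩⟩

end HomAcyclic

/-! ### Gorenstein projective modules through presentations -/

section Modules

variable {A : Type u} [Ring A]

theorem acyclic_iff_exact (K : CochainComplex (ModuleCat.{u} A) ℤ) : K.Acyclic ↔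
    ∀ i j k : ℤ, i + 1 = j → j + 1 = k → Function.Exact (K.d i j).hom (K.d j k).hom := by
  constructor
  · intro h i j k hi hk
    have := h j
    rw [K.exactAt_iff' i j k (by simp; lia) (by simp; lia)] at this
    exact (ShortComplex.ShortExact.moduleCat_exact_iff_function_exact _).1 this
  · intro h j
    rw [K.exactAt_iff' (j - 1) j (j + 1) (by simp) (by simp)]
    exact (ShortComplex.ShortExact.moduleCat_exact_iff_function_exact _).2
      (h _ _ _ (by lia) rfl)

theorem shortExact_mk {X Y Z : Type u} [AddCommGroup X] [AddCommGroup Y] [AddCommGroup Z]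
    [Module A X] [Module A Y] [Module A Z] (f : X →ₗ[A] Y) (g : Y →ₗ[A] Z)
    (hf : Function.Injective f) (h : Function.Exact f g) (hg : Function.Surjective g) :
    (ShortComplex.mk (ModuleCat.ofHom f) (ModuleCat.ofHom g) (by
      ext x; exact h.apply_apply_eq_zero x)).ShortExact where
  exact := (ShortComplex.ShortExact.moduleCat_exact_iff_function_exact _).2 h
  mono_f := (ModuleCat.mono_iff_injective _).2 hf
  epi_g := (ModuleCat.epi_iff_surjective _).2 hg

/-- The syzygies of a complete resolution are presented by its differentials. -/
theorem IsGorensteinProjective.of_presentation {P : CochainComplex (ModuleCat.{u} A) ℤ}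
    (hP : IsCompleteProjectiveResolution P) {G : ModuleCat.{u} A} (g : P.X 0 ⟶ G)
    (hg : Function.Surjective g.hom) (h : Function.Exact (P.d (-1) 0).hom g.hom) :
    IsGorensteinProjective G := by
  have hex := (acyclic_iff_exact P).1 hP.acyclic (-1) 0 1 (by simp) (by simp)
  have hker : LinearMap.ker g.hom = LinearMap.ker (P.d 0 1).hom := by
    rw [LinearMap.exact_iff.1 h, LinearMap.exact_iff.1 hex]
  let e : (P.X 0 ⧸ LinearMap.ker g.hom) ≃ₗ[A] G := g.hom.quotKerEquivOfSurjective hg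
  let m : G ⟶ P.X 1 := ModuleCat.ofHom
    ((LinearMap.ker g.hom).liftQ (P.d 0 1).hom hker.le ∘ₗ e.symm.toLinearMap)
  have hgm : g ≫ m = P.d 0 1 := by
    ext x
    have : e.symm (g.hom x) = Submodule.Quotient.mk x := by
      rw [LinearEquiv.symm_apply_eq]; rfl
    change (LinearMap.ker g.hom).liftQ (P.d 0 1).hom hker.le (e.symm (g.hom x)) = _
    rw [this]
    rfl
  have : Mono m := by
    have hinj : Function.Injective ((LinearMap.ker g.hom).liftQ (P.d 0 1).hom hker.le) := by
      rw [← LinearMap.ker_eq_bot]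
      exact Submodule.ker_liftQ_eq_bot _ _ _ hker.ge
    exact (ModuleCat.mono_iff_injective m).2 (hinj.comp e.symm.injective)
  have : Epi g := (ModuleCat.epi_iff_surjective g).2 hg
  have : StrongEpi g := strongEpi_of_epi g
  exact ⟨P, hP, ⟨Limits.image.isoStrongEpiMono g m hgm⟩⟩

theorem IsGorensteinProjective.exists_factorization {G : ModuleCat.{u} A}
    (hG : IsGorensteinProjective G) : ∃ P : CochainComplex (ModuleCat.{u} A) ℤ,
      IsCompleteProjectiveResolution P ∧ ∃ (p : P.X 0 ⟶ G) (j : G ⟶ P.X 1),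
        Function.Surjective p.hom ∧ Function.Injective j.hom ∧ p ≫ j = P.d 0 1 ∧
        Function.Exact (P.d (-1) 0).hom p.hom := by
  obtain ⟨P, hP, ⟨i⟩⟩ := hG
  have hex := (acyclic_iff_exact P).1 hP.acyclic (-1) 0 1 (by simp) (by simp)
  have hp := (ModuleCat.epi_iff_surjective (Limits.factorThruImage (P.d 0 1) ≫ i.inv)).1
    inferInstance
  have hj := (ModuleCat.mono_iff_injective (i.hom ≫ Limits.image.ι (P.d 0 1))).1
    inferInstance
  have hpj : (Limits.factorThruImage (P.d 0 1) ≫ i.inv) ≫ i.hom ≫ Limits.image.ι (P.d 0 1) =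
      P.d 0 1 := by simp
  refine ⟨P, hP, _, _, hp, hj, hpj, fun x => ?_⟩
  rw [← hex x, ← ModuleCat.hom_ext_iff.1 hpj]
  exact (map_eq_zero_iff _ hj).symm

/-- Reduces Hom conditions on projective targets to free ones; functors carry the retract along. -/
theorem Projective.retract_finsupp (N : ModuleCat.{u} A) [Projective N] :
    Nonempty (Retract N (ModuleCat.of A (N →₀ A))) := by
  have : Module.Projective A N := (IsProjective.iff_projective N).2 inferInstance
  obtain ⟨s, hs⟩ := Module.projective_def'.1 this
  exact ⟨⟨ModuleCat.ofHom s, ModuleCat.ofHom (Finsupp.linearCombination A id),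
    ModuleCat.hom_ext hs⟩⟩

theorem memAdd_of_equiv {W N : ModuleCat.{u} A} {I : Type u} (e : N ≃ₗ[A] (I →₀ W)) :
    MemAdd W N :=
  ⟨I, ModuleCat.of A PUnit, ⟨LinearEquiv.prodUnique.trans e⟩⟩

end Modules

/-! ### Tensor products over a noncommutative ring -/

namespace BalTensor

section Exactness

variable {S : Type*} [Ring S] {R : Type*} [Ring R]
  {M : Type*} [AddCommGroup M] [Module S M] [Module Rᵐᵒᵖ M] [SMulCommClass S Rᵐᵒᵖ M]
  {X : Type*} [AddCommGroup X] [Module R X] {Y : Type*} [AddCommGroup Y] [Module R Y]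
  {Z : Type*} [AddCommGroup Z] [Module R Z]

theorem addHom_ext {P : Type*} [AddCommGroup P] {f g : BalTensor R M X →+ P}
    (h : ∀ m x, f (tmul R m x) = g (tmul R m x)) : f = g := by
  ext z
  induction z using induction_on with
  | zero => simp only [map_zero]
  | tmul m x => exact h m x
  | add a b ha hb => rw [map_add, map_add, ha, hb]

theorem linearMap_ext {P : Type*} [AddCommGroup P] [Module S P] {f g : BalTensor R M X →ₗ[S] P}
    (h : ∀ m x, f (tmul R m x) = g (tmul R m x)) : f = g := by
  ext z
  exact DFunLike.congr_fun (addHom_ext (f := f.toAddMonoidHom) (g := g.toAddMonoidHom) h) z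

variable (S) in
/-- A biadditive, balanced and left linear map induces a linear map on the tensor product. -/
def liftLinear {P : Type*} [AddCommGroup P] [Module S P] (f : M →+ X →+ P)
    (hf : ∀ (m : M) (r : R) (x : X), f (op r • m) x = f m (r • x))
    (hs : ∀ (s : S) (m : M) (x : X), f (s • m) x = s • f m x) : BalTensor R M X →ₗ[S] P where
  toFun := lift f hf
  map_add' := map_add _
  map_smul' s z := by
    induction z using induction_on with
    | zero => simp only [smul_zero, map_zero]
    | tmul m x => exact hs s m x
    | add a b ha hb => simp only [smul_add, map_add, ha, hb]

@[simp]
theorem liftLinear_tmul {P : Type*} [AddCommGroup P] [Module S P] (f : M →+ X →+ P)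
    (hf : ∀ (m : M) (r : R) (x : X), f (op r • m) x = f m (r • x))
    (hs : ∀ (s : S) (m : M) (x : X), f (s • m) x = s • f m x) (m : M) (x : X) :
    liftLinear S f hf hs (tmul R m x) = f m x := rfl

theorem lTensor_comp (g : Y →ₗ[R] Z) (f : X →ₗ[R] Y) :
    lTensor S M (g ∘ₗ f) = lTensor S M g ∘ₗ lTensor S M f :=
  linearMap_ext fun _ _ => rfl

theorem lTensor_comp_apply (g : Y →ₗ[R] Z) (f : X →ₗ[R] Y) (z : BalTensor R M X) :
    lTensor S M (g ∘ₗ f) z = lTensor S M g (lTensor S M f z) :=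
  LinearMap.congr_fun (lTensor_comp g f) z

theorem lTensor_id : lTensor S M (LinearMap.id : X →ₗ[R] X) = LinearMap.id :=
  linearMap_ext fun _ _ => rfl

theorem lTensor_zero : lTensor S M (0 : X →ₗ[R] Y) = 0 :=
  linearMap_ext fun m _ => tmul_zero m

theorem lTensor_neg (f : X →ₗ[R] Y) : lTensor S M (-f) = -lTensor S M f := by
  rw [eq_neg_iff_add_eq_zero, ← lTensor_add, neg_add_cancel, lTensor_zero]

theorem lTensor_sub (f g : X →ₗ[R] Y) :
    lTensor S M (f - g) = lTensor S M f - lTensor S M g := by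
  rw [sub_eq_add_neg, lTensor_add, lTensor_neg, sub_eq_add_neg]

variable (S M)

theorem lTensor_surjective {f : X →ₗ[R] Y} (hf : Function.Surjective f) :
    Function.Surjective (lTensor S M f) := fun z => by
  induction z using induction_on with
  | zero => exact ⟨0, map_zero _⟩
  | tmul m y =>
    obtain ⟨x, rfl⟩ := hf y
    exact ⟨tmul R m x, rfl⟩
  | add a b ha hb =>
    obtain ⟨a, rfl⟩ := ha
    obtain ⟨b, rfl⟩ := hb
    exact ⟨a + b, map_add _ _ _⟩

/-- `M ⊗_R -` is right exact. -/
theorem lTensor_exact {f : X →ₗ[R] Y} {g : Y →ₗ[R] Z} (h : Function.Exact f g)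
    (hg : Function.Surjective g) : Function.Exact (lTensor S M f) (lTensor S M g) := by
  rw [LinearMap.exact_iff]
  refine le_antisymm (fun w hw => ?_) ?_
  · let N := LinearMap.range (lTensor S M f)
    have key (m : M) {y y' : Y} (hy : g y = g y') :
        N.mkQ (tmul R m y) = N.mkQ (tmul R m y') := by
      obtain ⟨x, hx⟩ := (h (y - y')).1 (by rw [map_sub, hy, sub_self])
      rw [← sub_eq_zero, ← map_sub, Submodule.mkQ_apply, Submodule.Quotient.mk_eq_zero]
      refine ⟨tmul R m x, ?_⟩
      rw [lTensor_tmul, hx, eq_sub_iff_add_eq, ← tmul_add, sub_add_cancel]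
    -- A set-theoretic section suffices: by `key`, the class of m ⊗ y modulo the image of 1 ⊗ f
    -- depends only on g y. So m ⊗ z ↦ [m ⊗ s z] is additive and balanced, and it recovers the class
    -- of w from its image in M ⊗ Z.
    let s := Function.surjInv hg
    have hs : ∀ z, g (s z) = z := Function.surjInv_eq hg
    let φ : M →+ Z →+ (BalTensor R M Y ⧸ N) :=
      { toFun := fun m =>
          { toFun := fun z => N.mkQ (tmul R m (s z))
            map_zero' := by rw [key m (y' := 0) (by rw [hs, map_zero]), tmul_zero, map_zero]
            map_add' := fun z z' => by
              rw [← map_add, ← tmul_add]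
              exact key m (by rw [map_add, hs, hs, hs]) }
        map_zero' := by ext z; exact (congrArg N.mkQ (zero_tmul _)).trans (map_zero _)
        map_add' := fun m m' => by
          ext z; exact (congrArg N.mkQ (add_tmul _ _ _)).trans (map_add _ _ _) }
    let ψ : BalTensor R M Z →+ (BalTensor R M Y ⧸ N) := lift φ fun m r z => by
      change N.mkQ (tmul R (op r • m) (s z)) = N.mkQ (tmul R m (s (r • z)))
      rw [op_smul_tmul]
      exact key m (by rw [map_smul, hs, hs])
    have hψ : ψ.comp (lTensor S M g).toAddMonoidHom = N.mkQ.toAddMonoidHom :=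
      addHom_ext fun m y => key m (hs _)
    have := DFunLike.congr_fun hψ w
    rw [← Submodule.Quotient.mk_eq_zero (p := N)]
    refine this.symm.trans ?_
    change ψ (lTensor S M g w) = 0
    rw [LinearMap.mem_ker.1 hw, map_zero]
  · rintro _ ⟨w, rfl⟩
    rw [LinearMap.mem_ker, ← lTensor_comp_apply, h.linearMap_comp_eq_zero, lTensor_zero,
      LinearMap.zero_apply]

instance [Subsingleton X] : Subsingleton (BalTensor R M X) :=
  subsingleton_of_forall_eq 0 fun z => by
    induction z using induction_on with
    | zero => rfl
    | tmul m x => rw [Subsingleton.elim x 0, tmul_zero]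
    | add a b ha hb => rw [ha, hb, add_zero]

theorem subsingleton_of_left [Subsingleton M] : Subsingleton (BalTensor R M X) :=
  subsingleton_of_forall_eq 0 fun z => by
    induction z using induction_on with
    | zero => rfl
    | tmul m x => rw [Subsingleton.elim m 0, zero_tmul]
    | add a b ha hb => rw [ha, hb, add_zero]

end Exactness

section Assoc

variable (S R M Q L Z : Type*) [Ring S] [Ring R] [AddCommGroup M] [Module S M] [Module Rᵐᵒᵖ M]
  [SMulCommClass S Rᵐᵒᵖ M] [Ring Q] [AddCommGroup L] [Module R L] [Module Qᵐᵒᵖ L]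
  [SMulCommClass R Qᵐᵒᵖ L] [AddCommGroup Z] [Module Q Z]

/-- The associativity map `(m ⊗ n) ⊗ z ↦ m ⊗ (n ⊗ z)`. -/
def assocHom : BalTensor Q (BalTensor R M L) Z →ₗ[S] BalTensor R M (BalTensor Q L Z) :=
  let g (z : Z) : L →ₗ[R] BalTensor Q L Z :=
    { toFun := fun n => tmul Q n z
      map_add' := fun n n' => add_tmul n n' z
      map_smul' := fun _ _ => rfl }
  have hg (z z' : Z) : g (z + z') = g z + g z' := LinearMap.ext fun n => tmul_add n z z'
  have hg0 : g 0 = 0 := LinearMap.ext fun n => tmul_zero n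
  liftLinear S
    (AddMonoidHom.flip
      { toFun := fun z => (lTensor S M (g z)).toAddMonoidHom
        map_zero' := by rw [hg0, lTensor_zero]; rfl
        map_add' := fun z z' => by rw [hg, lTensor_add]; rfl })
    (fun w q z => by
      change lTensor S M (g z) (op q • w) = lTensor S M (g (q • z)) w
      induction w using induction_on with
      | zero => simp only [smul_zero, map_zero]
      | tmul m n =>
        rw [op_smul_tmul_right, lTensor_tmul, lTensor_tmul]
        exact congrArg (tmul R m) (op_smul_tmul n q z)
      | add a b ha hb => simp only [smul_add, map_add, ha, hb])
    (fun s w z => map_smul (lTensor S M (g z)) s w)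

/-- The associativity isomorphism `(m ⊗ n) ⊗ z ↦ m ⊗ (n ⊗ z)`. -/
def assocEquiv : BalTensor Q (BalTensor R M L) Z ≃ₗ[S] BalTensor R M (BalTensor Q L Z) :=
  LinearEquiv.ofLinearMap (assocHom S R M Q L Z) (assocInv S R M Q L Z)
    (linearMap_ext fun m w => by
      induction w using induction_on with
      | zero => simp only [tmul_zero, map_zero]
      | tmul n z => rfl
      | add a b ha hb => simp only [tmul_add, map_add, ha, hb])
    (linearMap_ext fun w z => by
      induction w using induction_on with
      | zero => simp only [zero_tmul, map_zero]
      | tmul m n => rfl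
      | add a b ha hb => simp only [add_tmul, map_add, ha, hb])

end Assoc

section Finsupp

variable (S R N : Type*) [Ring S] [Ring R] [AddCommGroup N] [Module S N] [Module Rᵐᵒᵖ N]
  [SMulCommClass S Rᵐᵒᵖ N] (I W : Type*) [AddCommGroup W] [Module R W]

/-- The tensor product commutes with direct sums of copies of a module. -/
def finsuppEquiv : BalTensor R N (I →₀ W) ≃ₗ[S] (I →₀ BalTensor R N W) :=
  LinearEquiv.ofLinearMap
    (liftLinear S
      { toFun := fun n => Finsupp.mapRange.addMonoidHom (mk (R := R) n)
        map_zero' := by ext f i; simp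
        map_add' := fun n n' => by ext f i; simp }
      (fun n r f => by ext i; simp [op_smul_tmul])
      (fun s n f => by ext i; simp))
    (Finsupp.lsum ℕ fun i => lTensor S N (Finsupp.lsingle i))
    (by
      ext i : 1
      refine linearMap_ext fun n x => ?_
      simp)
    (linearMap_ext fun n f => by
      induction f using Finsupp.induction_linear with
      | zero => simp only [tmul_zero, map_zero]
      | add f g hf hg => simp only [tmul_add, map_add, hf, hg]
      | single i w => simp)

end Finsupp

end BalTensor

/-! ### Extension of scalars and its right adjoint -/

section Adjunction

open BalTensor

section Linear

variable {S R : Type*} [Ring S] [Ring R] [Module Rᵐᵒᵖ S] [SMulCommClass S Rᵐᵒᵖ S]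
  (φ : R →+* S) (hφ : ∀ (r : R) (s : S), op r • s = s * φ r)
  {X : Type*} [AddCommGroup X] [Module R X] {Y : Type*} [AddCommGroup Y] [Module R Y]
  [Module S Y] (hY : ∀ (r : R) (y : Y), r • y = φ r • y)

/-- The extension `s ⊗ x ↦ s f(x)` of a linear map along `φ : R → S`. -/
def extendMap (f : X →ₗ[R] Y) : BalTensor R S X →ₗ[S] Y :=
  liftLinear S
    { toFun := fun s =>
        { toFun := fun x => s • f x
          map_zero' := by rw [map_zero, smul_zero]
          map_add' := fun x x' => by rw [map_add, smul_add] }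
      map_zero' := by ext x; exact zero_smul S (f x)
      map_add' := fun s s' => by ext x; exact add_smul s s' (f x) }
    (fun s r x => by
      change (op r • s) • f x = s • f (r • x)
      rw [map_smul, hφ, mul_smul, hY])
    (fun t s x => mul_smul t s (f x))

/-- The map `x ↦ g (1 ⊗ x)`. -/
def restrictMap (g : BalTensor R S X →ₗ[S] Y) : X →ₗ[R] Y where
  toFun x := g (tmul R 1 x)
  map_add' x x' := by rw [tmul_add, map_add]
  map_smul' r x := by
    rw [← op_smul_tmul, hφ, RingHom.id_apply, hY, ← map_smul, smul_tmul, one_mul, smul_eq_mul,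
      mul_one]

theorem extendMap_restrictMap (g : BalTensor R S X →ₗ[S] Y) :
    extendMap φ hφ hY (restrictMap φ hφ hY g) = g :=
  linearMap_ext fun s x => by
    change s • g (tmul R 1 x) = _
    rw [← map_smul, smul_tmul, smul_eq_mul, mul_one]

theorem restrictMap_extendMap (f : X →ₗ[R] Y) :
    restrictMap φ hφ hY (extendMap φ hφ hY f) = f :=
  LinearMap.ext fun x => one_smul S (f x)

end Linear

variable {S R : Type u} [Ring S] [Ring R] [Module Rᵐᵒᵖ S] [SMulCommClass S Rᵐᵒᵖ S]
  (φ : R →+* S) (hφ : ∀ (r : R) (s : S), op r • s = s * φ r)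

/-- Extension of scalars along `φ : R → S` is left adjoint to restriction of scalars. -/
def tensorRestrictAdj : tensorFunctor S R S ⊣ ModuleCat.restrictScalars.{u} φ :=
  Adjunction.mkOfHomEquiv
    { homEquiv := fun _ Y =>
        { toFun := fun f => ModuleCat.ofHom (Y := (ModuleCat.restrictScalars φ).obj Y)
            (restrictMap (Y := (ModuleCat.restrictScalars φ).obj Y) φ hφ (fun _ _ => rfl) f.hom)
          invFun := fun g => ModuleCat.ofHom
            (extendMap (Y := (ModuleCat.restrictScalars φ).obj Y) φ hφ (fun _ _ => rfl) g.hom)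
          left_inv := fun f => ModuleCat.hom_ext
            (extendMap_restrictMap (Y := (ModuleCat.restrictScalars φ).obj Y) φ hφ
              (fun _ _ => rfl) f.hom)
          right_inv := fun g => ModuleCat.hom_ext
            (restrictMap_extendMap (Y := (ModuleCat.restrictScalars φ).obj Y) φ hφ
              (fun _ _ => rfl) g.hom) }
      homEquiv_naturality_left_symm := fun _ _ => ModuleCat.hom_ext <| linearMap_ext fun _ _ => rfl
      homEquiv_naturality_right := fun _ _ => rfl }

theorem tensorFunctor_projective (φ : R →+* S) (hφ : ∀ (r : R) (s : S), op r • s = s * φ r)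
    (X : ModuleCat.{u} R) [Projective X] : Projective ((tensorFunctor S R S).obj X) := by
  have : (ModuleCat.restrictScalars.{u} φ).PreservesEpimorphisms :=
    ⟨fun f hf => (ModuleCat.epi_iff_surjective _).2 ((ModuleCat.epi_iff_surjective f).1 hf)⟩
  exact (tensorRestrictAdj φ hφ).map_projective X inferInstance

end Adjunction

section GorensteinTransfer

open BalTensor

variable {S R : Type u} [Ring S] [Ring R] {N : Type u} [AddCommGroup N] [Module S N]
  [Module Rᵐᵒᵖ N] [SMulCommClass S Rᵐᵒᵖ N]

/-- A tensor functor preserves Gorenstein projectives if it preserves complete resolutions. -/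
theorem IsGorensteinProjective.tensorFunctor
    (h : ∀ P : CochainComplex (ModuleCat.{u} R) ℤ, IsCompleteProjectiveResolution P →
      IsCompleteProjectiveResolution (((tensorFunctor S R N).mapHomologicalComplex _).obj P))
    {Y : ModuleCat.{u} R} (hY : IsGorensteinProjective Y) :
    IsGorensteinProjective ((_root_.tensorFunctor S R N).obj Y) := by
  obtain ⟨P, hP, p, j, hp, -, -, hex⟩ := hY.exists_factorization
  -- Right exactness carries the presentation P^{-1} → P^0 → Y over; nothing has to be known about
  -- the embedding of Y in P^1.
  exact .of_presentation (h P hP) ((_root_.tensorFunctor S R N).map p)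
    (lTensor_surjective S N hp) (lTensor_exact S N hex hp)

end GorensteinTransfer

open BalTensor

/-! ### The bar map and contractions -/

namespace AssocBimoduleHom

section Pairs

variable {R : Type u} [Ring R] {M : Type u} [AddCommGroup M] [Module R M] [Module Rᵐᵒᵖ M]
  [SMulCommClass R Rᵐᵒᵖ M] (θ : AssocBimoduleHom R M)
  {X : Type u} [AddCommGroup X] [Module R X] {Y : Type u} [AddCommGroup Y] [Module R Y]

@[simp]
theorem tensorId_tmul (m n : M) (x : X) :
    θ.tensorId X (tmul R m (tmul R n x)) = tmul R (θ.toLinearMap (tmul R m n)) x := rfl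

theorem tensorId_naturality (f : X →ₗ[R] Y) :
    θ.tensorId Y ∘ₗ lTensor R M (lTensor R M f) = lTensor R M f ∘ₗ θ.tensorId X :=
  linearMap_ext fun m w => by
    induction w using induction_on with
    | zero => simp only [tmul_zero, map_zero]
    | tmul n x => rfl
    | add a b ha hb => simp only [tmul_add, map_add, ha, hb]

/-- Associativity of θ. It makes `θ.tensorId X` itself an action on `M ⊗_R X`. -/
theorem tensorId_assoc (X : Type u) [AddCommGroup X] [Module R X] :
    θ.tensorId X ∘ₗ lTensor R M (θ.tensorId X) =
      θ.tensorId X ∘ₗ θ.tensorId (BalTensor R M X) :=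
  linearMap_ext fun m w => by
    induction w using induction_on with
    | zero => simp only [tmul_zero, map_zero]
    | add a b ha hb => simp only [tmul_add, map_add, ha, hb]
    | tmul n v =>
      induction v using induction_on with
      | zero => simp only [tmul_zero, map_zero]
      | add a b ha hb => simp only [tmul_add, map_add, ha, hb]
      | tmul p x => simp [θ.assoc]

/-- The map `1_M ⊗ α - θ ⊗ 1_X : M ⊗_R M ⊗_R X → M ⊗_R X`. -/
def barMap (α : BalTensor R M X →ₗ[R] X) :
    BalTensor R M (BalTensor R M X) →ₗ[R] BalTensor R M X :=
  lTensor R M α - θ.tensorId X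

variable {θ}

theorem IsAction.comp_barMap {α : BalTensor R M X →ₗ[R] X} (hα : θ.IsAction α) :
    α ∘ₗ θ.barMap α = 0 := by
  rw [barMap, LinearMap.comp_sub, hα, sub_self]

theorem IsAction.apply_barMap {α : BalTensor R M X →ₗ[R] X} (hα : θ.IsAction α)
    (w : BalTensor R M (BalTensor R M X)) : α (θ.barMap α w) = 0 :=
  LinearMap.congr_fun hα.comp_barMap w

theorem barMap_naturality {α : BalTensor R M X →ₗ[R] X} {β : BalTensor R M Y →ₗ[R] Y}
    {f : X →ₗ[R] Y} (h : f ∘ₗ α = β ∘ₗ lTensor R M f) :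
    θ.barMap β ∘ₗ lTensor R M (lTensor R M f) = lTensor R M f ∘ₗ θ.barMap α := by
  rw [barMap, barMap, LinearMap.sub_comp, LinearMap.comp_sub, tensorId_naturality,
    ← lTensor_comp, ← lTensor_comp, h]

/-- The kernel of `T ⊗_R X → X` is the `T`-module `(M ⊗_R X, θ ⊗ 1_X - 1_M ⊗ α)`. -/
theorem IsAction.neg_barMap {α : BalTensor R M X →ₗ[R] X} (hα : θ.IsAction α) :
    θ.IsAction (-θ.barMap α) := by
  have h := θ.tensorId_naturality α
  have h2 : lTensor R M α ∘ₗ lTensor R M (lTensor R M α) =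
      lTensor R M α ∘ₗ lTensor R M (θ.tensorId X) := by
    rw [← lTensor_comp, ← lTensor_comp, hα]
  rw [IsAction, lTensor_neg, LinearMap.neg_comp, LinearMap.neg_comp, LinearMap.comp_neg,
    neg_neg, barMap, lTensor_sub]
  simp only [LinearMap.sub_comp, LinearMap.comp_sub, tensorId_assoc, h, h2]
  abel

/-- A map `σ : X → M ⊗_R X` that contracts `M ⊗_R M ⊗_R X → M ⊗_R X → X` in the middle. It exists
when `(X, α)` is a direct summand of an induced module. -/
def IsContraction (θ : AssocBimoduleHom R M) (α : BalTensor R M X →ₗ[R] X)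
    (σ : X →ₗ[R] BalTensor R M X) : Prop :=
  σ ∘ₗ α + θ.barMap α ∘ₗ lTensor R M σ = LinearMap.id

theorem IsContraction.exists_barMap {α : BalTensor R M X →ₗ[R] X}
    {σ : X →ₗ[R] BalTensor R M X} (hσ : θ.IsContraction α σ) {w : BalTensor R M X}
    (hw : α w = 0) : ∃ u, θ.barMap α u = w := by
  refine ⟨lTensor R M σ w, ?_⟩
  have : σ (α w) + θ.barMap α (lTensor R M σ w) = w := LinearMap.congr_fun hσ w
  rwa [hw, map_zero, zero_add] at this

/-- The two terms involving θ cancel by naturality, and what remains is M ⊗ - applied to the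
contraction identity for σ. This keeps the induction in `exists_eq_d_add_action` going. -/
theorem IsContraction.neg_barMap {α : BalTensor R M X →ₗ[R] X}
    {σ : X →ₗ[R] BalTensor R M X} (hσ : θ.IsContraction α σ) :
    θ.IsContraction (-θ.barMap α) (-lTensor R M σ) := by
  have h := θ.tensorId_naturality σ
  have h2 : lTensor R M σ ∘ₗ lTensor R M α +
      lTensor R M (θ.barMap α) ∘ₗ lTensor R M (lTensor R M σ) = LinearMap.id := by
    rw [← lTensor_comp, ← lTensor_comp, ← lTensor_add, hσ, lTensor_id]
  have hb : θ.barMap (-θ.barMap α) =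
    lTensor R M (-θ.barMap α) - θ.tensorId (BalTensor R M X) := rfl
  rw [IsContraction, hb, lTensor_neg, lTensor_neg]
  simp only [LinearMap.neg_comp, LinearMap.comp_neg, neg_neg, LinearMap.sub_comp, h]
  rw [← h2]
  nth_rewrite 1 [barMap]
  rw [LinearMap.comp_sub]
  abel

/-- Tensoring a complex with `M`. -/
abbrev tensorComplex (R M : Type u) [Ring R] [AddCommGroup M] [Module R M] [Module Rᵐᵒᵖ M]
    [SMulCommClass R Rᵐᵒᵖ M] (K : CochainComplex (ModuleCat.{u} R) ℤ) :
    CochainComplex (ModuleCat.{u} R) ℤ :=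
  ((tensorFunctor R R M).mapHomologicalComplex _).obj K

/-- Let `K` be a complex of contractible modules over the extension. If the complexes
`M ⊗_R ⋯ ⊗_R M ⊗_R K` are acyclic and eventually zero, then the complex of cokernels of the actions
is acyclic. -/
theorem exists_eq_d_add_action (n : ℕ) : ∀ (K : CochainComplex (ModuleCat.{u} R) ℤ)
    (α : ∀ i, BalTensor R M (K.X i) →ₗ[R] K.X i) (σ : ∀ i, K.X i →ₗ[R] BalTensor R M (K.X i)),
    (∀ i, θ.IsAction (α i)) → (∀ i, θ.IsContraction (α i) (σ i)) →
    (∀ i j, (K.d i j).hom ∘ₗ α i = α j ∘ₗ lTensor R M (K.d i j).hom) →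
    (∀ j, ((tensorComplex R M)^[j] K).Acyclic) →
    (∀ i, Subsingleton (((tensorComplex R M)^[n] K).X i)) →
    ∀ h i j : ℤ, h + 1 = i → i + 1 = j → ∀ (y : K.X i) (w : BalTensor R M (K.X j)),
      (K.d i j).hom y = α j w →
      ∃ (x : K.X h) (v : BalTensor R M (K.X i)), y = (K.d h i).hom x + α i v := by
  induction n with
  | zero =>
    intro K α σ _ _ _ _ h0 h i j _ _ y w _
    have : Subsingleton (K.X i) := h0 i
    exact ⟨0, 0, Subsingleton.elim _ _⟩
  | succ n ih =>
    intro K α σ hα hσ hd hex h0 h i j hi hj y w hyw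
    have hK := (acyclic_iff_exact K).1 (hex 0)
    -- As d² = 0, the action kills (1 ⊗ d) w, and the contraction turns this into a value of the bar
    -- map. So w satisfies, for M ⊗ K with action -bar and one degree higher, the hypothesis that y
    -- satisfies for K.
    have hw : α (j + 1) (lTensor R M (K.d j (j + 1)).hom w) = 0 := by
      have := LinearMap.congr_fun (hd j (j + 1)) w
      refine this.symm.trans ?_
      rw [LinearMap.comp_apply, ← hyw]
      exact (hK i j (j + 1) hj rfl).apply_apply_eq_zero y
    obtain ⟨v, hv⟩ := (hσ (j + 1)).exists_barMap hw
    have hd' (i j : ℤ) : lTensor R M (K.d i j).hom ∘ₗ (-θ.barMap (α i)) =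
        (-θ.barMap (α j)) ∘ₗ lTensor R M (lTensor R M (K.d i j).hom) := by
      rw [LinearMap.comp_neg, LinearMap.neg_comp, barMap_naturality (hd i j)]
    have hv' : lTensor R M (K.d j (j + 1)).hom w = (-θ.barMap (α (j + 1))) (-v) := by
      rw [map_neg, LinearMap.neg_apply, neg_neg, hv]
    obtain ⟨x, v', hx⟩ : ∃ (x : BalTensor R M (K.X i)) (v' : BalTensor R M (BalTensor R M (K.X j))),
        w = lTensor R M (K.d i j).hom x + (-θ.barMap (α j)) v' :=
      ih (tensorComplex R M K) (fun i => -θ.barMap (α i)) (fun i => -lTensor R M (σ i))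
        (fun i => (hα i).neg_barMap) (fun i => (hσ i).neg_barMap) hd'
        (fun j => hex (j + 1)) h0 i j (j + 1) hj rfl w (-v) hv'
    -- The bar part of w dies under α, so y and α x have the same differential and acyclicity of K
    -- finishes.
    have hy : (K.d i j).hom (y - α i x) = 0 := by
      have : (K.d i j).hom (α i x) = α j (lTensor R M (K.d i j).hom x) :=
        LinearMap.congr_fun (hd i j) x
      rw [map_sub, hyw, hx, map_add, LinearMap.neg_apply, map_neg, (hα j).apply_barMap, this,
        neg_zero, add_zero, sub_self]
    obtain ⟨z, hz⟩ := (hK h i j hi hj _).1 hy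
    exact ⟨z, x, by rw [hz, sub_add_cancel]⟩

end Pairs

/-! ### The decomposition of T ⊗_R X, and R ⊗_T X as a cokernel -/

section Extension

variable {R : Type u} [Ring R] {M : Type u} [AddCommGroup M] [Module R M] [Module Rᵐᵒᵖ M]
  [SMulCommClass R Rᵐᵒᵖ M] (θ : AssocBimoduleHom R M)
  {X : Type u} [AddCommGroup X] [Module R X] {Y : Type u} [AddCommGroup Y] [Module R Y]

@[simp] theorem incl_fst (r : R) : (θ.incl r).fst = r := rfl
@[simp] theorem incl_snd (r : R) : (θ.incl r).snd = 0 := rfl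

theorem op_smul_ext (r : R) (t : θ.Ext) : op r • t = t * θ.incl r := rfl

theorem op_smul_base (t : θ.Ext) (r : R) : op t • r = r * θ.proj t := rfl

@[simp] theorem op_smul_ext_fst (r : R) (t : θ.Ext) : (op r • t).fst = t.fst * r := rfl

@[simp] theorem op_smul_ext_snd (r : R) (t : θ.Ext) : (op r • t).snd = op r • t.snd := by
  rw [op_smul_ext]
  simp [tmul_zero]

/-- The inclusion of the ideal `M` into the extension. -/
def inr : M →+ θ.Ext where
  toFun m := ⟨0, m⟩
  map_zero' := rfl
  map_add' m m' := by ext <;> simp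

@[simp] theorem inr_fst (m : M) : (θ.inr m).fst = 0 := rfl
@[simp] theorem inr_snd (m : M) : (θ.inr m).snd = m := rfl

theorem incl_fst_add_inr_snd (t : θ.Ext) : θ.incl t.fst + θ.inr t.snd = t := by
  ext <;> simp

variable (X) in
/-- The component `t ⊗ x ↦ t₀ x` of `T ⊗_R X ≃ X ⊕ M ⊗_R X`. -/
def fstMap : BalTensor R θ.Ext X →+ X :=
  lift
    { toFun := fun t => DistribSMul.toAddMonoidHom X t.fst
      map_zero' := by ext x; exact zero_smul R x
      map_add' := fun s t => by ext x; exact add_smul s.fst t.fst x }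
    fun t r x => mul_smul t.fst r x

variable (X) in
/-- The component `t ⊗ x ↦ t₁ ⊗ x` of `T ⊗_R X ≃ X ⊕ M ⊗_R X`. -/
def sndMap : BalTensor R θ.Ext X →+ BalTensor R M X :=
  lift
    { toFun := fun t => BalTensor.mk (R := R) t.snd
      map_zero' := by ext x; exact zero_tmul x
      map_add' := fun s t => by ext x; exact add_tmul s.snd t.snd x }
    fun t r x => by
      change tmul R (op r • t).snd x = tmul R t.snd (r • x)
      rw [op_smul_ext_snd, op_smul_tmul]

variable (X) in
/-- The inclusion `m ⊗ x ↦ (0, m) ⊗ x`. -/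
def inrMap : BalTensor R M X →+ BalTensor R θ.Ext X :=
  lift (BalTensor.mk.comp θ.inr) fun m r x => by
    change tmul R (θ.inr (op r • m)) x = tmul R (θ.inr m) (r • x)
    rw [← op_smul_tmul]
    congr 1
    ext <;> simp

@[simp] theorem fstMap_tmul (t : θ.Ext) (x : X) : θ.fstMap X (tmul R t x) = t.fst • x := rfl
@[simp] theorem sndMap_tmul (t : θ.Ext) (x : X) : θ.sndMap X (tmul R t x) = tmul R t.snd x := rfl
@[simp] theorem inrMap_tmul (m : M) (x : X) : θ.inrMap X (tmul R m x) = tmul R (θ.inr m) x := rfl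

@[simp]
theorem fstMap_inrMap (w : BalTensor R M X) : θ.fstMap X (θ.inrMap X w) = 0 :=
  DFunLike.congr_fun (f := (θ.fstMap X).comp (θ.inrMap X)) (g := 0)
    (addHom_ext fun _ x => zero_smul R x) w

@[simp]
theorem sndMap_inrMap (w : BalTensor R M X) : θ.sndMap X (θ.inrMap X w) = w :=
  DFunLike.congr_fun (f := (θ.sndMap X).comp (θ.inrMap X)) (g := AddMonoidHom.id _)
    (addHom_ext fun _ _ => rfl) w

theorem decompose (z : BalTensor R θ.Ext X) :
    tmul R (1 : θ.Ext) (θ.fstMap X z) + θ.inrMap X (θ.sndMap X z) = z :=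
  DFunLike.congr_fun
    (f := ((BalTensor.mk (R := R) (1 : θ.Ext)).comp (θ.fstMap X)) + (θ.inrMap X).comp (θ.sndMap X))
    (g := AddMonoidHom.id _)
    (addHom_ext fun t x => by
      change tmul R (1 : θ.Ext) (t.fst • x) + tmul R (θ.inr t.snd) x = tmul R t x
      rw [← op_smul_tmul, op_smul_ext, one_mul, ← add_tmul, incl_fst_add_inr_snd]) z

theorem ext_iff_components {z z' : BalTensor R θ.Ext X} :
    z = z' ↔ θ.fstMap X z = θ.fstMap X z' ∧ θ.sndMap X z = θ.sndMap X z' :=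
  ⟨fun h => h ▸ ⟨rfl, rfl⟩, fun h => by rw [← θ.decompose z, h.1, h.2, θ.decompose]⟩

theorem fstMap_smul (t : θ.Ext) (z : BalTensor R θ.Ext X) :
    θ.fstMap X (t • z) = t.fst • θ.fstMap X z :=
  DFunLike.congr_fun (f := (θ.fstMap X).comp (DistribSMul.toAddMonoidHom _ t))
    (g := (DistribSMul.toAddMonoidHom _ t.fst).comp (θ.fstMap X))
    (addHom_ext fun s x => mul_smul t.fst s.fst x) z

theorem sndMap_smul (t : θ.Ext) (z : BalTensor R θ.Ext X) :
    θ.sndMap X (t • z) = t.fst • θ.sndMap X z + tmul R t.snd (θ.fstMap X z) +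
      θ.tensorId X (tmul R t.snd (θ.sndMap X z)) := by
  induction z using induction_on with
  | zero => simp only [smul_zero, map_zero, tmul_zero, add_zero]
  | add a b ha hb =>
    simp only [smul_add, map_add, ha, hb, tmul_add]
    abel
  | tmul s x => simp [add_tmul, op_smul_tmul]

theorem fstMap_lTensor (f : X →ₗ[R] Y) (z : BalTensor R θ.Ext X) :
    θ.fstMap Y (lTensor θ.Ext θ.Ext f z) = f (θ.fstMap X z) :=
  DFunLike.congr_fun (f := (θ.fstMap Y).comp (lTensor θ.Ext θ.Ext f).toAddMonoidHom)
    (g := f.toAddMonoidHom.comp (θ.fstMap X))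
    (addHom_ext fun t x => (map_smul f t.fst x).symm) z

theorem sndMap_lTensor (f : X →ₗ[R] Y) (z : BalTensor R θ.Ext X) :
    θ.sndMap Y (lTensor θ.Ext θ.Ext f z) = lTensor R M f (θ.sndMap X z) :=
  DFunLike.congr_fun (f := (θ.sndMap Y).comp (lTensor θ.Ext θ.Ext f).toAddMonoidHom)
    (g := (lTensor R M f).toAddMonoidHom.comp (θ.sndMap X))
    (addHom_ext fun _ _ => rfl) z

/-- `T ⊗_R -` preserves exactness at `X → Y → Z` if `M ⊗_R -` does. -/
theorem lTensor_ext_exact {Z : Type u} [AddCommGroup Z] [Module R Z] {f : X →ₗ[R] Y}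
    {g : Y →ₗ[R] Z} (h : Function.Exact f g)
    (hM : Function.Exact (lTensor R M f) (lTensor R M g)) :
    Function.Exact (lTensor θ.Ext θ.Ext f) (lTensor θ.Ext θ.Ext g) := fun z => by
  constructor
  · intro hz
    obtain ⟨x, hx⟩ := (h (θ.fstMap Y z)).1 (by rw [← fstMap_lTensor, hz, map_zero])
    obtain ⟨w, hw⟩ := (hM (θ.sndMap Y z)).1 (by rw [← sndMap_lTensor, hz, map_zero])
    refine ⟨tmul R (1 : θ.Ext) x + θ.inrMap X w, ?_⟩
    rw [ext_iff_components]
    simp [fstMap_lTensor, sndMap_lTensor, hx, hw, zero_tmul]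
  · rintro ⟨z, rfl⟩
    rw [ext_iff_components]
    simp [fstMap_lTensor, sndMap_lTensor, h.apply_apply_eq_zero, hM.apply_apply_eq_zero]

section Action

variable [Module θ.Ext X] [Module θ.Ext Y]

/-- The `R`- and `T`-module structures on `X` make it the `T`-module of the pair `(X, α)`. -/
def Induces (α : BalTensor R M X →ₗ[R] X) : Prop :=
  ∀ (t : θ.Ext) (x : X), t • x = t.fst • x + α (tmul R t.snd x)

/-- The action `m ⊗ x ↦ (0, m) x` of `M` on a `T`-module. -/
def act (hX : ∀ (r : R) (x : X), r • x = θ.incl r • x) : BalTensor R M X →ₗ[R] X :=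
  liftLinear R
    { toFun := fun m => DistribSMul.toAddMonoidHom X (θ.inr m)
      map_zero' := by ext x; simp
      map_add' := fun m m' => by ext x; simp [add_smul] }
    (fun m r x => by
      change θ.inr (op r • m) • x = θ.inr m • r • x
      rw [hX, ← mul_smul]
      congr 1
      ext <;> simp [tmul_zero])
    (fun r m x => by
      change θ.inr (r • m) • x = r • θ.inr m • x
      rw [hX, ← mul_smul]
      congr 1
      ext <;> simp [zero_tmul])

theorem induces_act (hX : ∀ (r : R) (x : X), r • x = θ.incl r • x) : θ.Induces (θ.act hX) :=
  fun t x => by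
    change t • x = t.fst • x + θ.inr t.snd • x
    rw [hX, ← add_smul, incl_fst_add_inr_snd]

variable {θ} {α : BalTensor R M X →ₗ[R] X} {β : BalTensor R M Y →ₗ[R] Y}

theorem Induces.incl_smul (h : θ.Induces α) (r : R) (x : X) : r • x = θ.incl r • x := by
  rw [h]
  simp [zero_tmul]

theorem Induces.inr_smul (h : θ.Induces α) (m : M) (x : X) : θ.inr m • x = α (tmul R m x) := by
  rw [h]
  simp

theorem Induces.isAction (h : θ.Induces α) : θ.IsAction α :=
  linearMap_ext fun m w => by
    induction w using induction_on with
    | zero => simp only [tmul_zero, map_zero]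
    | add a b ha hb => simp only [tmul_add, map_add, ha, hb]
    | tmul n x =>
      simp only [LinearMap.comp_apply, lTensor_tmul, tensorId_tmul, ← h.inr_smul, ← mul_smul]
      congr 1
      ext <;> simp

theorem Induces.naturality (h : θ.Induces α) (h' : θ.Induces β) {f : X →ₗ[R] Y}
    (hf : ∀ (t : θ.Ext) (x : X), f (t • x) = t • f x) : f ∘ₗ α = β ∘ₗ lTensor R M f :=
  linearMap_ext fun m x => by
    simp only [LinearMap.comp_apply, lTensor_tmul, ← h.inr_smul, ← h'.inr_smul, hf]

/-- The multiplication map `T ⊗_R X → X`. -/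
def Induces.mulMap (h : θ.Induces α) : BalTensor R θ.Ext X →ₗ[θ.Ext] X :=
  extendMap θ.incl (fun _ _ => rfl) h.incl_smul LinearMap.id

theorem Induces.mulMap_apply (h : θ.Induces α) (z : BalTensor R θ.Ext X) :
    h.mulMap z = θ.fstMap X z + α (θ.sndMap X z) :=
  DFunLike.congr_fun (f := h.mulMap.toAddMonoidHom)
    (g := θ.fstMap X + α.toAddMonoidHom.comp (θ.sndMap X)) (addHom_ext fun t x => h t x) z

theorem Induces.mulMap_surjective (h : θ.Induces α) : Function.Surjective h.mulMap :=
  fun x => ⟨tmul R (1 : θ.Ext) x, one_smul _ _⟩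

/-- Projectivity splits T ⊗_R X → X over T. The contraction is the M ⊗ X component of the section s;
the other component is then forced to be x - α (σ x), and linearity of s for the elements (0, m) is
the contraction identity. -/
theorem Induces.exists_isContraction (h : θ.Induces α) [Module.Projective θ.Ext X] :
    ∃ σ, θ.IsContraction α σ := by
  obtain ⟨s, hs⟩ := Module.projective_lifting_property h.mulMap LinearMap.id h.mulMap_surjective
  let σ : X →ₗ[R] BalTensor R M X :=
    { toFun := fun x => θ.sndMap X (s x)
      map_add' := fun x y => by rw [map_add, map_add]
      map_smul' := fun r x => by
        rw [h.incl_smul, map_smul, sndMap_smul]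
        simp [zero_tmul] }
  have hfst (x : X) : θ.fstMap X (s x) = x - α (σ x) := by
    rw [eq_sub_iff_add_eq]
    exact (h.mulMap_apply (s x)).symm.trans (LinearMap.congr_fun hs x)
  refine ⟨σ, linearMap_ext fun m x => ?_⟩
  have : σ (α (tmul R m x)) = tmul R m (x - α (σ x)) + θ.tensorId X (tmul R m (σ x)) := by
    change θ.sndMap X (s (α (tmul R m x))) = _
    rw [← h.inr_smul, map_smul, sndMap_smul, hfst]
    simp [σ]
  simp only [LinearMap.add_apply, LinearMap.comp_apply, this, lTensor_tmul, barMap,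
    LinearMap.sub_apply, LinearMap.id_apply]
  rw [sub_eq_add_neg x, tmul_add, ← neg_one_smul ℤ]
  have hn : tmul R m (-1 • α (σ x)) = -tmul R m (α (σ x)) := by
    rw [neg_one_smul ℤ]
    exact map_neg (BalTensor.mk (R := R) m) _
  rw [hn]
  abel

/-- The map r ⊗ x ↦ [r x] to X / Im α is balanced over T and detects 1 ⊗ x. Conversely (0, m) moves
across the tensor sign and acts on R as zero. -/
theorem Induces.one_tmul_eq_zero_iff (h : θ.Induces α) (x : X) :
    tmul θ.Ext (1 : R) x = 0 ↔ ∃ w, α w = x := by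
  constructor
  · intro hx
    let f : R →+ X →+ (X ⧸ LinearMap.range α) :=
      { toFun := fun r => (LinearMap.range α).mkQ.toAddMonoidHom.comp
          (DistribSMul.toAddMonoidHom X r)
        map_zero' := by ext x; simp
        map_add' := fun r r' => by ext x; simp [add_smul] }
    let g : BalTensor θ.Ext R X →+ (X ⧸ LinearMap.range α) := lift f fun r t x => by
      change (LinearMap.range α).mkQ ((r * t.fst) • x) = (LinearMap.range α).mkQ (r • t • x)
      have h0 : (LinearMap.range α).mkQ (α (r • tmul R t.snd x)) = 0 :=
        (Submodule.Quotient.mk_eq_zero _).2 (LinearMap.mem_range_self α _)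
      rw [h t x, smul_add, map_add, mul_smul, ← map_smul α, h0, add_zero]
    have hg : g (tmul θ.Ext (1 : R) x) = (LinearMap.range α).mkQ x :=
      congrArg (LinearMap.range α).mkQ (one_smul R x)
    rw [hx, map_zero] at hg
    exact (Submodule.Quotient.mk_eq_zero _).1 hg.symm
  · rintro ⟨w, rfl⟩
    induction w using induction_on with
    | zero => rw [map_zero, tmul_zero]
    | tmul m x =>
      rw [← h.inr_smul, ← op_smul_tmul, op_smul_base]
      have : (1 : R) * θ.proj (θ.inr m) = 0 := mul_zero 1
      rw [this, zero_tmul]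
    | add a b ha hb => rw [map_add, tmul_add, ha, hb, add_zero]

theorem Induces.exists_one_tmul (h : θ.Induces α) (z : BalTensor θ.Ext R X) :
    ∃ x, z = tmul θ.Ext (1 : R) x := by
  induction z using induction_on with
  | zero => exact ⟨0, (tmul_zero _).symm⟩
  | tmul r x =>
    refine ⟨r • x, ?_⟩
    rw [h.incl_smul, ← op_smul_tmul, op_smul_base, one_mul]
    rfl
  | add a b ha hb =>
    obtain ⟨x, rfl⟩ := ha
    obtain ⟨y, rfl⟩ := hb
    exact ⟨x + y, (tmul_add _ _ _).symm⟩

/-- `R ⊗_T X` is the cokernel of the action of `M`. -/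
def Induces.cokerEquiv (h : θ.Induces α) :
    (X ⧸ LinearMap.range α) ≃ₗ[R] BalTensor θ.Ext R X :=
  let f : X →ₗ[R] BalTensor θ.Ext R X :=
    { toFun := fun x => tmul θ.Ext (1 : R) x
      map_add' := tmul_add _
      map_smul' := fun r x => by
        rw [h.incl_smul, ← op_smul_tmul, op_smul_base, RingHom.id_apply, smul_tmul, one_mul,
          smul_eq_mul, mul_one]
        rfl }
  have hf : LinearMap.range α = LinearMap.ker f :=
    Submodule.ext fun x => (h.one_tmul_eq_zero_iff x).symm
  (Submodule.quotEquivOfEq _ _ hf).trans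
    (f.quotKerEquivOfSurjective fun z => (h.exists_one_tmul z).imp fun _ => Eq.symm)

/-- Every element of R ⊗_T X is some 1 ⊗ x, so exactness after R ⊗_T - can be tested on elements of
X, Y, Z modulo the images of the actions. -/
theorem Induces.qExact_iff {Z : Type u} [AddCommGroup Z] [Module R Z] [Module θ.Ext Z]
    {γ : BalTensor R M Z →ₗ[R] Z} (hα : θ.Induces α) (hβ : θ.Induces β) (hγ : θ.Induces γ)
    {f : X →ₗ[θ.Ext] Y} {g : Y →ₗ[θ.Ext] Z} (hfg : ∀ x, g (f x) = 0) :
    Function.Exact (lTensor R R f : BalTensor θ.Ext R X →ₗ[R] _)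
      (lTensor R R g : BalTensor θ.Ext R Y →ₗ[R] _) ↔
    ∀ (y : Y) (w : BalTensor R M Z), g y = γ w →
      ∃ (x : X) (v : BalTensor R M Y), y = f x + β v := by
  constructor
  · intro h y w hw
    obtain ⟨z, hz⟩ := (h (tmul θ.Ext (1 : R) y)).1
      ((hγ.one_tmul_eq_zero_iff _).2 ⟨w, hw.symm⟩)
    obtain ⟨x, rfl⟩ := hα.exists_one_tmul z
    have : tmul θ.Ext (1 : R) (y - f x) = 0 := by
      rw [lTensor_tmul] at hz
      exact (map_sub (BalTensor.mk (R := θ.Ext) (1 : R)) y (f x)).trans (sub_eq_zero.2 hz.symm)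
    obtain ⟨v, hv⟩ := (hβ.one_tmul_eq_zero_iff _).1 this
    exact ⟨x, v, by rw [hv, add_sub_cancel]⟩
  · intro h z
    obtain ⟨y, rfl⟩ := hβ.exists_one_tmul z
    constructor
    · intro hz
      obtain ⟨w, hw⟩ := (hγ.one_tmul_eq_zero_iff _).1 hz
      obtain ⟨x, v, rfl⟩ := h y w hw.symm
      refine ⟨tmul θ.Ext (1 : R) x, ?_⟩
      rw [tmul_add, (hβ.one_tmul_eq_zero_iff _).2 ⟨v, rfl⟩, add_zero, lTensor_tmul]
    · rintro ⟨z, hz⟩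
      rw [← hz]
      obtain ⟨x, rfl⟩ := hα.exists_one_tmul z
      rw [lTensor_tmul, lTensor_tmul, hfg, tmul_zero]

end Action

end Extension

end AssocBimoduleHom

theorem HomAcyclic.of_subsingleton {A : Type u} [Ring A] {P : CochainComplex (ModuleCat.{u} A) ℤ}
    (N : ModuleCat.{u} A) [Subsingleton N] : HomAcyclic P N := fun i f _ =>
  ⟨0, by ext x; exact Subsingleton.elim _ _⟩

theorem acyclic_of_iso {A : Type u} [Ring A] {K L : CochainComplex (ModuleCat.{u} A) ℤ}
    (e : K ≅ L) (h : K.Acyclic) : L.Acyclic := fun i => (h i).of_iso e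

namespace BalTensor

section

variable (S R M : Type*) [Ring S] [Ring R] [AddCommGroup M] [Module S M] [Module Rᵐᵒᵖ M]
  [SMulCommClass S Rᵐᵒᵖ M] {X : Type*} [AddCommGroup X] [Module R X] {Y : Type*} [AddCommGroup Y]
  [Module R Y]

/-- The isomorphism `1_M ⊗ e`. -/
def lTensorEquiv (e : X ≃ₗ[R] Y) : BalTensor R M X ≃ₗ[S] BalTensor R M Y :=
  LinearEquiv.ofLinearMap (lTensor S M e.toLinearMap) (lTensor S M e.symm.toLinearMap)
    (by rw [← lTensor_comp, LinearEquiv.comp_symm, lTensor_id])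
    (by rw [← lTensor_comp, LinearEquiv.symm_comp, lTensor_id])

variable (X) in
/-- The isomorphism `R ⊗_R X ≃ X`. -/
def lidEquiv : BalTensor R R X ≃ₗ[R] X :=
  LinearEquiv.ofLinearMap
    (extendMap (RingHom.id R) (fun _ _ => rfl) (fun _ _ => rfl) LinearMap.id)
    (restrictMap (RingHom.id R) (fun _ _ => rfl) (fun _ _ => rfl) LinearMap.id)
    (LinearMap.ext fun x => one_smul R x)
    (linearMap_ext fun r x => by
      change tmul R (1 : R) (r • x) = tmul R r x
      rw [← op_smul_tmul, op_smul_eq_mul, one_mul])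

/-- The isomorphism `M ⊗_R R ≃ M`. -/
def ridEquiv : BalTensor R M R ≃ₗ[S] M :=
  LinearEquiv.ofLinearMap
    (liftLinear S
      { toFun := fun m =>
          { toFun := fun r => op r • m
            map_zero' := zero_smul _ m
            map_add' := fun r r' => by rw [MulOpposite.op_add, add_smul] }
        map_zero' := by ext r; exact smul_zero (op r)
        map_add' := fun m m' => by ext r; exact smul_add (op r) m m' }
      (fun m r x => (mul_smul (op x) (op r) m).symm)
      (fun s m r => (smul_comm s (op r) m).symm))
    { toFun := fun m => tmul R m 1
      map_add' := fun m m' => add_tmul m m' 1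
      map_smul' := fun _ _ => rfl }
    (LinearMap.ext fun m => one_smul Rᵐᵒᵖ m)
    (linearMap_ext fun m r => by
      change tmul R (op r • m) (1 : R) = tmul R m r
      rw [op_smul_tmul, smul_eq_mul, mul_one])

theorem lidEquiv_naturality (f : X →ₗ[R] Y) :
    (lidEquiv R Y).toLinearMap ∘ₗ lTensor R R f = f ∘ₗ (lidEquiv R X).toLinearMap :=
  linearMap_ext fun r x => (map_smul f r x).symm

theorem assocEquiv_naturality {L : Type*} [AddCommGroup L] [Module R L] [Module Rᵐᵒᵖ L]
    [SMulCommClass R Rᵐᵒᵖ L] (f : X →ₗ[R] Y) :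
    (assocEquiv S R M R L Y).toLinearMap ∘ₗ lTensor S (BalTensor R M L) f =
      lTensor S M (lTensor R L f) ∘ₗ (assocEquiv S R M R L X).toLinearMap :=
  linearMap_ext fun w x => by
    induction w using induction_on with
    | zero => simp only [zero_tmul, map_zero]
    | tmul m n => rfl
    | add a b ha hb => simp only [add_tmul, map_add, ha, hb]

end

end BalTensor

namespace AssocBimoduleHom

variable {R : Type u} [Ring R] {M : Type u} [AddCommGroup M] [Module R M] [Module Rᵐᵒᵖ M]
  [SMulCommClass R Rᵐᵒᵖ M] (θ : AssocBimoduleHom R M)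

section TensorPowers

variable (M) in
/-- Tensoring a complex with `M ^ j` is the same as tensoring `j` times with `M`. -/
theorem nonempty_tensorPow_iso (K : CochainComplex (ModuleCat.{u} R) ℤ) (j : ℕ) :
    Nonempty (((tensorFunctor R R (tensorPow R M j).carrier).mapHomologicalComplex _).obj K ≅
      (tensorComplex R M)^[j] K) := by
  induction j with
  | zero =>
    exact ⟨HomologicalComplex.Hom.isoOfComponents (fun i => (lidEquiv R (K.X i)).toModuleIso)
      (fun i j _ => ModuleCat.hom_ext (lidEquiv_naturality R (K.d i j).hom).symm)⟩
  | succ j ih =>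
    obtain ⟨e⟩ := ih
    rw [Function.iterate_succ_apply']
    refine ⟨?_ ≪≫ ((tensorFunctor R R M).mapHomologicalComplex _).mapIso e⟩
    exact HomologicalComplex.Hom.isoOfComponents
      (fun i => (assocEquiv R R M R (tensorPow R M j).carrier (K.X i)).toModuleIso)
      (fun i k _ => ModuleCat.hom_ext
        (assocEquiv_naturality R R M (L := (tensorPow R M j).carrier) (K.d i k).hom).symm)

end TensorPowers

/-! ### T ⊗_R - preserves complete resolutions -/

section Left

/-- `0 → M → T → R → 0` splits over `R`, so `Hom(P, -)` is acyclic on free `T`-modules if it is on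
direct sums of copies of `R` and `M`. -/
theorem homAcyclic_restrict_free {P : CochainComplex (ModuleCat.{u} R) ℤ}
    [∀ i, Projective (P.X i)] (I : Type u) (hR : HomAcyclic P (ModuleCat.of R (I →₀ R)))
    (hM : HomAcyclic P (ModuleCat.of R (I →₀ M))) :
    HomAcyclic P (θ.e.obj (ModuleCat.of θ.Ext (I →₀ θ.Ext))) := by
  let f : (I →₀ M) →ₗ[R] (θ.e.obj (ModuleCat.of θ.Ext (I →₀ θ.Ext))) :=
    { toFun := fun v => (Finsupp.mapRange.addMonoidHom θ.inr v : I →₀ θ.Ext)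
      map_add' := fun v w => map_add (Finsupp.mapRange.addMonoidHom θ.inr) v w
      map_smul' := fun r v => by
        refine Finsupp.ext (M := θ.Ext) fun i => ?_
        change θ.inr (r • v i) = θ.incl r * θ.inr (v i)
        ext <;> simp [zero_tmul] }
  let g : (θ.e.obj (ModuleCat.of θ.Ext (I →₀ θ.Ext))) →ₗ[R] (I →₀ R) :=
    { toFun := fun v => Finsupp.mapRange.addMonoidHom θ.proj.toAddMonoidHom (v : I →₀ θ.Ext)
      map_add' := fun v w => map_add (Finsupp.mapRange.addMonoidHom θ.proj.toAddMonoidHom) v w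
      map_smul' := fun r v => Finsupp.ext fun i => rfl }
  refine HomAcyclic.of_shortExact_mid (shortExact_mk f g ?_ ?_ ?_) hM hR
  · intro v w h
    ext i
    exact congrArg Ext.snd (DFunLike.congr_fun (F := I →₀ θ.Ext) h i)
  · intro v
    constructor
    · intro h
      refine ⟨Finsupp.mapRange.addMonoidHom
        { toFun := Ext.snd, map_zero' := rfl, map_add' := fun _ _ => rfl } (v : I →₀ θ.Ext), ?_⟩
      refine Finsupp.ext (M := θ.Ext) fun i => ?_
      have := DFunLike.congr_fun (F := I →₀ R) h i
      exact Ext.ext this.symm rfl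
    · rintro ⟨w, rfl⟩
      exact Finsupp.ext fun i => rfl
  · intro v
    exact ⟨(Finsupp.mapRange.addMonoidHom θ.incl.toAddMonoidHom v : I →₀ θ.Ext),
      Finsupp.ext fun i => rfl⟩

variable {θ}

theorem BaseAcyclicity.homAcyclic_finsupp (h : θ.BaseAcyclicity)
    {P : CochainComplex (ModuleCat.{u} R) ℤ} (hP : IsCompleteProjectiveResolution P) (I : Type u) :
    HomAcyclic P (ModuleCat.of R (I →₀ M)) :=
  (h P hP).2 _ (memAdd_of_equiv (W := ModuleCat.of R M) (LinearEquiv.refl R (I →₀ M)))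

theorem _root_.IsCompleteProjectiveResolution.homAcyclic_free {A : Type u} [Ring A]
    {P : CochainComplex (ModuleCat.{u} A) ℤ} (hP : IsCompleteProjectiveResolution P) (I : Type u) :
    HomAcyclic P (ModuleCat.of A (I →₀ A)) :=
  hP.hom_acyclic _ ((IsProjective.iff_projective _).1 inferInstance)

theorem BaseAcyclicity.l_complete (h : θ.BaseAcyclicity)
    {P : CochainComplex (ModuleCat.{u} R) ℤ} (hP : IsCompleteProjectiveResolution P) :
    IsCompleteProjectiveResolution ((θ.l.mapHomologicalComplex _).obj P) where
  projective i :=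
    have := hP.projective i
    tensorFunctor_projective θ.incl (fun _ _ => rfl) (P.X i)
  acyclic := by
    rw [acyclic_iff_exact]
    intro i j k hi hk
    exact θ.lTensor_ext_exact ((acyclic_iff_exact _).1 hP.acyclic i j k hi hk)
      ((acyclic_iff_exact _).1 (h P hP).1 i j k hi hk)
  hom_acyclic N hN := by
    have := hP.projective
    rw [homAcyclic_iff_of_adjunction (tensorRestrictAdj θ.incl fun _ _ => rfl)]
    obtain ⟨r⟩ := Projective.retract_finsupp N
    exact (θ.homAcyclic_restrict_free N (hP.homAcyclic_free N)
      (h.homAcyclic_finsupp hP N)).of_retract (r.map θ.e)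

end Left

/-! ### R ⊗_T - preserves complete resolutions -/

section Right

/-- The action of `M` on a `T`-module. -/
def moduleAct (Z : ModuleCat.{u} θ.Ext) : BalTensor R M (θ.e.obj Z) →ₗ[R] (θ.e.obj Z) :=
  θ.act (X := θ.e.obj Z) (fun _ _ => rfl)

theorem induces_moduleAct (Z : ModuleCat.{u} θ.Ext) :
    θ.Induces (X := θ.e.obj Z) (θ.moduleAct Z) :=
  θ.induces_act _

theorem moduleAct_naturality {Z Z' : ModuleCat.{u} θ.Ext} (f : Z ⟶ Z') :
    (θ.e.map f).hom ∘ₗ θ.moduleAct Z = θ.moduleAct Z' ∘ₗ lTensor R M (θ.e.map f).hom :=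
  (θ.induces_moduleAct Z).naturality (θ.induces_moduleAct Z') fun t x => map_smul f.hom t x

theorem exists_isContraction_moduleAct (Z : ModuleCat.{u} θ.Ext) [hZ : Projective Z] :
    ∃ σ, θ.IsContraction (θ.moduleAct Z) σ := by
  have : Module.Projective θ.Ext (θ.e.obj Z) := (IsProjective.iff_projective Z).2 hZ
  exact (θ.induces_moduleAct Z).exists_isContraction

theorem q_acyclic_iff {Q : CochainComplex (ModuleCat.{u} θ.Ext) ℤ} :
    ((θ.q.mapHomologicalComplex _).obj Q).Acyclic ↔
    ∀ i j k : ℤ, i + 1 = j → j + 1 = k → ∀ (y : θ.e.obj (Q.X j))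
      (w : BalTensor R M (θ.e.obj (Q.X k))), (θ.e.map (Q.d j k)).hom y = θ.moduleAct (Q.X k) w →
      ∃ (x : θ.e.obj (Q.X i)) (v : BalTensor R M (θ.e.obj (Q.X j))),
        y = (θ.e.map (Q.d i j)).hom x + θ.moduleAct (Q.X j) v := by
  rw [acyclic_iff_exact]
  refine forall₃_congr fun i j k => forall₂_congr fun _ _ => ?_
  exact Induces.qExact_iff (θ.induces_moduleAct (Q.X i)) (θ.induces_moduleAct (Q.X j))
    (θ.induces_moduleAct (Q.X k)) (f := (Q.d i j).hom) (g := (Q.d j k).hom)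
    (fun x => LinearMap.congr_fun (ModuleCat.hom_ext_iff.1 (Q.d_comp_d i j k)) x)

/-- The kernel of `T ⊗_R Z → Z` is `M ⊗_R Z` as an `R`-module. -/
def kernelEquiv (Z : ModuleCat.{u} θ.Ext) :
    θ.e.obj (ModuleCat.of θ.Ext (LinearMap.ker (θ.induces_moduleAct Z).mulMap)) ≃ₗ[R]
      BalTensor R M (θ.e.obj Z) :=
  let f : θ.e.obj (ModuleCat.of θ.Ext (LinearMap.ker (θ.induces_moduleAct Z).mulMap)) →ₗ[R]
      BalTensor R M (θ.e.obj Z) :=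
    { toFun := fun z =>
        θ.sndMap (θ.e.obj Z) ((LinearMap.ker (θ.induces_moduleAct Z).mulMap).subtype z)
      map_add' := fun z z' => map_add (θ.sndMap _) _ _
      map_smul' := fun r z => (θ.sndMap_smul (θ.incl r) _).trans (by simp [zero_tmul]) }
  LinearEquiv.ofBijective f (by
      constructor
      · rintro ⟨z, hz⟩ ⟨z', hz'⟩ (h : θ.sndMap _ z = θ.sndMap _ z')
        rw [LinearMap.mem_ker, Induces.mulMap_apply, ← eq_neg_iff_add_eq_zero] at hz hz'
        exact Subtype.ext (θ.ext_iff_components.2 ⟨by rw [hz, hz', h], h⟩)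
      · intro w
        refine ⟨⟨tmul R (1 : θ.Ext) (-θ.moduleAct Z w) + θ.inrMap _ w, ?_⟩, ?_⟩
        · rw [LinearMap.mem_ker, Induces.mulMap_apply]
          simp [zero_tmul]
        · change θ.sndMap (θ.e.obj Z) (tmul R (1 : θ.Ext) (-θ.moduleAct Z w) + θ.inrMap _ w) = w
          simp [zero_tmul])

variable {θ}

/-- The terms of Q are projective over T, hence contractible, so `exists_eq_d_add_action` applies to
e(Q). The assumption on M^j ⊗ e(Q) concerns j > 0; for j = 0 exactness is that of Q. -/
theorem NilpotentAcyclicity.q_acyclic (h : θ.NilpotentAcyclicity)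
    {Q : CochainComplex (ModuleCat.{u} θ.Ext) ℤ} (hQ : IsCompleteProjectiveResolution Q) :
    ((θ.q.mapHomologicalComplex _).obj Q).Acyclic := by
  obtain ⟨⟨n, hn⟩, -, h⟩ := h
  have := hQ.projective
  choose σ hσ using fun i => θ.exists_isContraction_moduleAct (Q.X i)
  have hex : ((θ.e.mapHomologicalComplex _).obj Q).Acyclic := by
    rw [acyclic_iff_exact]
    exact (acyclic_iff_exact Q).1 hQ.acyclic
  rw [q_acyclic_iff]
  refine exists_eq_d_add_action (θ := θ) n ((θ.e.mapHomologicalComplex _).obj Q)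
    (fun i => θ.moduleAct (Q.X i)) σ (fun i => (θ.induces_moduleAct (Q.X i)).isAction) hσ
    (fun i j => θ.moduleAct_naturality (Q.d i j)) (fun j => ?_) (fun i => ?_)
  · rcases j.eq_zero_or_pos with rfl | hj
    · exact hex
    · obtain ⟨e⟩ := nonempty_tensorPow_iso M ((θ.e.mapHomologicalComplex _).obj Q) j
      exact acyclic_of_iso e (h Q hQ j hj).1
  · obtain ⟨e⟩ := nonempty_tensorPow_iso M ((θ.e.mapHomologicalComplex _).obj Q) n
    exact @Equiv.subsingleton _ _
      ((HomologicalComplex.eval _ _ i).mapIso e).toLinearEquiv.symm.toEquiv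
      (subsingleton_of_left (R := R) (M := (tensorPow R M n).carrier) (X := θ.e.obj (Q.X i)))

/-- Dimension shifting along 0 → M ⊗ Z → T ⊗ Z → Z → 0, by descending induction on k until M^k = 0.
Only the R-module underlying Z is prescribed, because the T-action on the kernel is not the one
induced by θ alone. -/
theorem NilpotentAcyclicity.homAcyclic_of_equiv (h : θ.NilpotentAcyclicity)
    {Q : CochainComplex (ModuleCat.{u} θ.Ext) ℤ} (hQ : IsCompleteProjectiveResolution Q)
    (I : Type u) (k : ℕ) (Z : ModuleCat.{u} θ.Ext)
    (e : θ.e.obj Z ≃ₗ[R] (I →₀ (tensorPow R M k).carrier)) : HomAcyclic Q Z := by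
  have := hQ.projective
  obtain ⟨⟨n, hn⟩, -, h⟩ := h
  have hsub (m : ℕ) : Subsingleton (tensorPow R M (n + m)).carrier := by
    induction m with
    | zero => exact hn
    | succ m ih => exact inferInstanceAs (Subsingleton (BalTensor R M (tensorPow R M (n + m)).carrier))
  have key (m : ℕ) : ∀ (k : ℕ), n ≤ k + m → ∀ (Z : ModuleCat.{u} θ.Ext),
      (θ.e.obj Z ≃ₗ[R] (I →₀ (tensorPow R M k).carrier)) → HomAcyclic Q Z := by
    induction m with
    | zero =>
      intro k hk Z e
      obtain ⟨m, rfl⟩ := Nat.exists_eq_add_of_le hk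
      have := hsub m
      have : Subsingleton Z := e.toEquiv.subsingleton
      exact .of_subsingleton Z
    | succ m ih =>
      intro k hk Z e
      refine HomAcyclic.of_shortExact_right (S := ShortComplex.mk _ _ _)
        (shortExact_mk (LinearMap.ker (θ.induces_moduleAct Z).mulMap).subtype
        (θ.induces_moduleAct Z).mulMap Subtype.val_injective
        (LinearMap.exact_subtype_ker_map _) (θ.induces_moduleAct Z).mulMap_surjective) ?_ ?_
      · exact ih (k + 1) (by lia) _ ((θ.kernelEquiv Z).trans
          ((lTensorEquiv R R M e).trans (finsuppEquiv R R M I (tensorPow R M k).carrier)))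
      · let e' := (lTensorEquiv θ.Ext R θ.Ext e).trans
          (finsuppEquiv θ.Ext R θ.Ext I (tensorPow R M k).carrier)
        -- The assumption on Add(T ⊗ M^k) covers k > 0; for k = 0 the middle term is extended from a
        -- free R-module, hence projective.
        rcases k.eq_zero_or_pos with rfl | hk
        · have : Projective (ModuleCat.of R (I →₀ R)) :=
            (IsProjective.iff_projective _).1 inferInstance
          exact (hQ.hom_acyclic _ (tensorFunctor_projective θ.incl (fun _ _ => rfl)
            (ModuleCat.of R (I →₀ R)))).of_iso (lTensorEquiv θ.Ext R θ.Ext e).symm.toModuleIso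
        · exact (h Q hQ k hk).2 _ (memAdd_of_equiv e')
  exact key n k (by lia) Z e

/-- Reduced to copies of R, this is an assumption in case (a), and in case (b) dimension shifting
started at M^0 = R. The linear equivalences are identity maps between two descriptions of the same
module. -/
theorem homAcyclic_restrict_proj (h : θ.ExtAcyclicity ∨ θ.NilpotentAcyclicity)
    {Q : CochainComplex (ModuleCat.{u} θ.Ext) ℤ} (hQ : IsCompleteProjectiveResolution Q)
    (N : ModuleCat.{u} R) [Projective N] :
    HomAcyclic Q ((ModuleCat.restrictScalars θ.proj).obj N) := by
  obtain ⟨r⟩ := Projective.retract_finsupp N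
  refine HomAcyclic.of_retract ?_ (r.map (ModuleCat.restrictScalars θ.proj))
  rcases h with h | h
  · refine (h Q hQ).2 _ (memAdd_of_equiv (I := N) ?_)
    exact
      { toFun := fun v => (v : N →₀ R)
        invFun := fun v => (v : N →₀ R)
        left_inv := fun _ => rfl
        right_inv := fun _ => rfl
        map_add' := fun _ _ => rfl
        map_smul' := fun t v => Finsupp.ext fun i => rfl }
  · refine h.homAcyclic_of_equiv hQ N 0 _ ?_
    exact
      { toFun := fun v => (v : N →₀ R)
        invFun := fun v => (v : N →₀ R)
        left_inv := fun _ => rfl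
        right_inv := fun _ => rfl
        map_add' := fun _ _ => rfl
        map_smul' := fun t v => Finsupp.ext fun i => rfl }

theorem q_acyclic (h : θ.ExtAcyclicity ∨ θ.NilpotentAcyclicity)
    {Q : CochainComplex (ModuleCat.{u} θ.Ext) ℤ} (hQ : IsCompleteProjectiveResolution Q) :
    ((θ.q.mapHomologicalComplex _).obj Q).Acyclic :=
  h.elim (fun h => (h Q hQ).1) (fun h => h.q_acyclic hQ)

theorem q_complete (h : θ.ExtAcyclicity ∨ θ.NilpotentAcyclicity)
    {Q : CochainComplex (ModuleCat.{u} θ.Ext) ℤ} (hQ : IsCompleteProjectiveResolution Q) :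
    IsCompleteProjectiveResolution ((θ.q.mapHomologicalComplex _).obj Q) where
  projective i :=
    have := hQ.projective i
    tensorFunctor_projective θ.proj (fun _ _ => rfl) (Q.X i)
  acyclic := q_acyclic h hQ
  hom_acyclic N _ := by
    rw [homAcyclic_iff_of_adjunction (tensorRestrictAdj θ.proj fun _ _ => rfl)]
    exact homAcyclic_restrict_proj h hQ N

end Right

/-! ### Necessary conditions for a Gorenstein projective pair -/

section Cokernel

variable {θ} {X : Type u} [AddCommGroup X] [Module R X] {α : BalTensor R M X →ₗ[R] X}

/-- Lift an element of Ker α to w in M ⊗ Y. Then β w lies in Im d, and `hq` lets w be changed by an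
element of (1 ⊗ d)(M ⊗ Y') so that β kills it. The contraction writes the result as a value of the
bar map, and 1 ⊗ p forgets the change. -/
theorem exact_barMap_of_presentation (hα : θ.IsAction α) {Y Y' : Type u} [AddCommGroup Y]
    [Module R Y] [AddCommGroup Y'] [Module R Y'] {β : BalTensor R M Y →ₗ[R] Y}
    {β' : BalTensor R M Y' →ₗ[R] Y'} {σ : Y →ₗ[R] BalTensor R M Y}
    (hσ : θ.IsContraction β σ) {d : Y' →ₗ[R] Y} {p : Y →ₗ[R] X}
    (hd : d ∘ₗ β' = β ∘ₗ lTensor R M d) (hp : p ∘ₗ β = α ∘ₗ lTensor R M p)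
    (hdp : Function.Exact d p) (hsurj : Function.Surjective p)
    (hq : ∀ y w, d y = β w → ∃ v, d y = d (β' v)) :
    Function.Exact (θ.barMap α) α := fun w => by
  constructor
  · intro hw
    obtain ⟨w, rfl⟩ := lTensor_surjective R M hsurj w
    obtain ⟨y, hy⟩ := (hdp (β w)).1 ((LinearMap.congr_fun hp w).trans hw)
    obtain ⟨v, hv⟩ := hq y w hy
    have hβ : β (w - lTensor R M d v) = 0 := by
      have : d (β' v) = β (lTensor R M d v) := LinearMap.congr_fun hd v
      rw [map_sub, ← hy, hv, this, sub_self]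
    obtain ⟨u, hu⟩ := hσ.exists_barMap hβ
    refine ⟨lTensor R M (lTensor R M p) u, ?_⟩
    have h1 := LinearMap.congr_fun (barMap_naturality (θ := θ) hp) u
    rw [LinearMap.comp_apply, LinearMap.comp_apply, hu, map_sub, ← lTensor_comp_apply,
      hdp.linearMap_comp_eq_zero, lTensor_zero, LinearMap.zero_apply, sub_zero] at h1
    exact h1
  · rintro ⟨u, rfl⟩
    exact hα.apply_barMap u

theorem induces_pairModule (hα : θ.IsAction α) :
    letI : Module θ.Ext X := (θ.pairModule α hα).isModule
    θ.Induces α := fun _ _ => rfl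

theorem gorenstein_coker (h : θ.ExtAcyclicity ∨ θ.NilpotentAcyclicity) (hα : θ.IsAction α)
    (hG : IsGorensteinProjective (θ.pairModule α hα)) :
    IsGorensteinProjective (ModuleCat.of R (X ⧸ LinearMap.range α)) := by
  let _ : Module θ.Ext X := (θ.pairModule α hα).isModule
  have hi : θ.Induces α := induces_pairModule hα
  exact (IsGorensteinProjective.tensorFunctor (fun _ => q_complete h) hG).of_iso
    hi.cokerEquiv.toModuleIso.symm

theorem exact_barMap_of_gorenstein (h : θ.ExtAcyclicity ∨ θ.NilpotentAcyclicity)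
    (hα : θ.IsAction α) (hG : IsGorensteinProjective (θ.pairModule α hα)) :
    Function.Exact (θ.barMap α) α := by
  let _ : Module θ.Ext X := (θ.pairModule α hα).isModule
  have hi : θ.Induces α := induces_pairModule hα
  obtain ⟨Q, hQ, p, -, hp, -, -, hex⟩ := hG.exists_factorization
  have := hQ.projective 0
  obtain ⟨σ, hσ⟩ := θ.exists_isContraction_moduleAct (Q.X 0)
  let p' : θ.e.obj (Q.X 0) →ₗ[R] X :=
    { toFun := fun x => p.hom x
      map_add' := fun x y => map_add p.hom x y
      map_smul' := fun r x => (map_smul p.hom (θ.incl r) x).trans (hi.incl_smul r (p.hom x)).symm }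
  refine exact_barMap_of_presentation hα hσ (d := (θ.e.map (Q.d (-1) 0)).hom) (p := p')
    (θ.moduleAct_naturality _)
    ((θ.induces_moduleAct (Q.X 0)).naturality hi fun t x => map_smul p.hom t x) hex hp ?_
  intro y w hy
  -- Acyclicity of R ⊗_T Q in degree -1 writes y as a boundary plus an action value; applying d
  -- removes the boundary.
  obtain ⟨x, v, hx⟩ := θ.q_acyclic_iff.1 (q_acyclic h hQ) (-2) (-1) 0 (by simp) (by simp) y w hy
  refine ⟨v, ?_⟩
  have hdd : (θ.e.map (Q.d (-1) 0)).hom ((θ.e.map (Q.d (-2) (-1))).hom x) = 0 :=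
    LinearMap.congr_fun (ModuleCat.hom_ext_iff.1 (Q.d_comp_d (-2) (-1) 0)) x
  rw [hx, map_add, hdd, zero_add]

end Cokernel

end AssocBimoduleHom

/-! ### Extending a single map to a cocycle -/

/-- Two-sided recursion: a relation between consecutive types that can be continued in both
directions has a bi-infinite chain through any given point. -/
theorem Int.exists_chain {S : ℤ → Type*} (rel : ∀ i j, S i → S j → Prop)
    (hs : ∀ i j, i + 1 = j → ∀ s : S i, ∃ s' : S j, rel i j s s')
    (hp : ∀ i j, i + 1 = j → ∀ s : S j, ∃ s' : S i, rel i j s' s) (b : ℤ) (s : S b) :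
    ∃ f : ∀ i, S i, f b = s ∧ ∀ i j, i + 1 = j → rel i j (f i) (f j) := by
  choose F hF using hs
  choose G hG using hp
  let f (i : ℤ) : S i := Int.inductionOn' (motive := S) i b s (fun k _ x => F k (k + 1) rfl x)
    (fun k _ x => G (k - 1) k (by lia) x)
  refine ⟨f, Int.inductionOn'_self, fun i j hij => ?_⟩
  rcases le_or_gt b i with h | h
  · subst hij
    have : f (i + 1) = F i (i + 1) rfl (f i) := Int.inductionOn'_add_one h
    rw [this]
    exact hF _ _ _ _
  · obtain rfl : i = j - 1 := by lia
    have : f (j - 1) = G (j - 1) j (by lia) (f j) := Int.inductionOn'_sub_one (by lia)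
    rw [this]
    exact hG _ _ _ _

/-- A map `P ^ (-1) ⟶ K ^ 0` extends to a cocycle of degree one if its coboundary conditions
allow it, for `P` a complex of projectives and `K` acyclic with `Hom(P, K ^ i)` acyclic. -/
theorem exists_cocycle {C : Type*} [Category C] [Abelian C] {P K : CochainComplex C ℤ}
    [∀ i, Projective (P.X i)] (hK : K.Acyclic) (h : ∀ i, HomAcyclic P (K.X i))
    (τ : P.X (-1) ⟶ K.X 0) (hτ : P.d (-2) (-1) ≫ τ ≫ K.d 0 1 = 0) :
    ∃ σ : ∀ i j, P.X i ⟶ K.X j, σ (-1) 0 = τ ∧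
      ∀ i j k, i + 1 = j → j + 1 = k → P.d i j ≫ σ j k + σ i j ≫ K.d j k = 0 := by
  -- A map is recorded for every target degree j to avoid dependent indices; only j = i + 1 matters.
  -- The condition d s d = 0 is exactly what either direction of the recursion needs, and each new
  -- map satisfies it again since d² = 0.
  let S (i : ℤ) := { s : ∀ j, P.X i ⟶ K.X j //
    ∀ h j k, h + 1 = i → i + 1 = j → j + 1 = k → P.d h i ≫ s j ≫ K.d j k = 0 }
  let extend (i j : ℤ) (s : P.X i ⟶ K.X j) (l : ℤ) : P.X i ⟶ K.X l :=
    if h : j = l then s ≫ eqToHom (by rw [h]) else 0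
  have extend_self (i j : ℤ) (s : P.X i ⟶ K.X j) : extend i j s j = s := by simp [extend]
  let rel (i j : ℤ) (s : S i) (s' : S j) : Prop :=
    ∀ k, j + 1 = k → P.d i j ≫ s'.1 k + s.1 j ≫ K.d j k = 0
  have hτ' (h j k : ℤ) (h1 : h + 1 = -1) (h2 : -1 + 1 = j) (h3 : j + 1 = k) :
      P.d h (-1) ≫ extend (-1) 0 τ j ≫ K.d j k = 0 := by
    obtain rfl : h = -2 := by lia
    obtain rfl : j = 0 := by lia
    obtain rfl : k = 1 := by lia
    rw [extend_self, hτ]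
  -- To the right, -(s d) is a cocycle in Hom(P, K^{j+1}) and extends along P^i → P^j.
  have hs (i j : ℤ) (hij : i + 1 = j) (s : S i) : ∃ s' : S j, rel i j s s' := by
    obtain ⟨g, hg⟩ := homAcyclic_iff.1 (h (j + 1)) (i - 1) i j (by lia) hij
      (-(s.1 j ≫ K.d j (j + 1))) (by
        rw [Preadditive.comp_neg, s.2 (i - 1) j (j + 1) (by lia) hij rfl, neg_zero])
    refine ⟨⟨extend j (j + 1) g, ?_⟩, ?_⟩
    · rintro h k l hh rfl hl
      obtain rfl : h = i := by lia
      rw [extend_self, reassoc_of% hg]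
      simp
    · rintro k rfl
      change P.d i j ≫ extend j (j + 1) g (j + 1) + _ = 0
      rw [extend_self, hg, neg_add_cancel]
  -- To the left, -(d s) is killed by the differential of K, so it lifts through K^j because K is
  -- exact and P^i is projective.
  have hp (i j : ℤ) (hij : i + 1 = j) (s : S j) : ∃ s' : S i, rel i j s' s := by
    have hz : (-(P.d i j ≫ s.1 (j + 1))) ≫ K.d (j + 1) (j + 1 + 1) = 0 := by
      rw [Preadditive.neg_comp, Category.assoc, s.2 i (j + 1) _ hij rfl rfl, neg_zero]
    have hex := (K.exactAt_iff' j (j + 1) (j + 1 + 1) (by simp) (by simp)).1 (hK (j + 1))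
    obtain ⟨g, hg⟩ : ∃ g : P.X i ⟶ K.X j, g ≫ K.d j (j + 1) = -(P.d i j ≫ s.1 (j + 1)) :=
      ⟨_, hex.liftFromProjective_comp _ hz⟩
    refine ⟨⟨extend i j g, ?_⟩, ?_⟩
    · rintro h k l hh hk rfl
      obtain rfl : k = j := by lia
      rw [extend_self, hg]
      simp
    · rintro k rfl
      change _ + extend i j g j ≫ _ = 0
      rw [extend_self, hg, add_neg_cancel]
  obtain ⟨f, hf, hrel⟩ := Int.exists_chain rel hs hp (-1) ⟨extend (-1) 0 τ, hτ'⟩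
  exact ⟨fun i => (f i).1, (congrArg (fun s => s.1 0) hf).trans (extend_self (-1) 0 τ),
    fun i j k hij hjk => hrel i j hij k hjk⟩

namespace AssocBimoduleHom

variable {R : Type u} [Ring R] {M : Type u} [AddCommGroup M] [Module R M] [Module Rᵐᵒᵖ M]
  [SMulCommClass R Rᵐᵒᵖ M] (θ : AssocBimoduleHom R M)

/-! ### Twisted complexes when θ = 0 -/

section Twist

variable {X Y Z : Type u} [AddCommGroup X] [Module R X] [AddCommGroup Y] [Module R Y]
  [AddCommGroup Z] [Module R Z]

/-- The `T`-linear map `T ⊗_R X → T ⊗_R Y` with `1 ⊗ x ↦ 1 ⊗ d x + s x`. -/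
def twistMap (d : X →ₗ[R] Y) (s : X →ₗ[R] BalTensor R M Y) :
    BalTensor R θ.Ext X →ₗ[θ.Ext] BalTensor R θ.Ext Y :=
  let f : X →ₗ[R] θ.e.obj (ModuleCat.of θ.Ext (BalTensor R θ.Ext Y)) :=
    { toFun := fun x => (tmul R (1 : θ.Ext) (d x) + θ.inrMap Y (s x) : BalTensor R θ.Ext Y)
      map_add' := fun x x' => by
        rw [map_add, map_add, map_add, tmul_add, add_add_add_comm]
        rfl
      map_smul' := fun r x => by
        change (tmul R (1 : θ.Ext) (d (r • x)) + θ.inrMap Y (s (r • x)) : BalTensor R θ.Ext Y) =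
          θ.incl r • (tmul R (1 : θ.Ext) (d x) + θ.inrMap Y (s x) : BalTensor R θ.Ext Y)
        rw [ext_iff_components, fstMap_smul, sndMap_smul]
        simp [zero_tmul] }
  extendMap (Y := θ.e.obj (ModuleCat.of θ.Ext (BalTensor R θ.Ext Y))) θ.incl (fun _ _ => rfl)
    (fun _ _ => rfl) f

theorem twistMap_tmul (d : X →ₗ[R] Y) (s : X →ₗ[R] BalTensor R M Y) (t : θ.Ext) (x : X) :
    θ.twistMap d s (tmul R t x) =
      t • (tmul R (1 : θ.Ext) (d x) + θ.inrMap Y (s x) : BalTensor R θ.Ext Y) := rfl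

variable {θ}

theorem tensorId_eq_zero (hθ : θ.toLinearMap = 0) : θ.tensorId X = 0 :=
  linearMap_ext fun m w => by
    induction w using induction_on with
    | zero => simp only [tmul_zero, map_zero]
    | tmul n x => simp [hθ, zero_tmul]
    | add a b ha hb => simp only [tmul_add, map_add, ha, hb]

theorem fstMap_twistMap (d : X →ₗ[R] Y) (s : X →ₗ[R] BalTensor R M Y)
    (z : BalTensor R θ.Ext X) : θ.fstMap Y (θ.twistMap d s z) = d (θ.fstMap X z) := by
  induction z using induction_on with
  | zero => simp only [map_zero]
  | add a b ha hb => simp only [map_add, ha, hb]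
  | tmul t x =>
    rw [twistMap_tmul, fstMap_smul]
    simp

/-- Here θ = 0 matters: M kills M ⊗ Y inside T ⊗ Y, so the twist is a triangular matrix with
diagonal d and 1 ⊗ d. -/
theorem sndMap_twistMap (hθ : θ.toLinearMap = 0) (d : X →ₗ[R] Y) (s : X →ₗ[R] BalTensor R M Y)
    (z : BalTensor R θ.Ext X) : θ.sndMap Y (θ.twistMap d s z) =
      s (θ.fstMap X z) + lTensor R M d (θ.sndMap X z) := by
  induction z using induction_on with
  | zero => simp only [map_zero, add_zero]
  | add a b ha hb =>
    simp only [map_add, ha, hb]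
    abel
  | tmul t x =>
    rw [twistMap_tmul, sndMap_smul, tensorId_eq_zero hθ]
    simp [zero_tmul]

theorem twistMap_comp (hθ : θ.toLinearMap = 0) {d : X →ₗ[R] Y} {s : X →ₗ[R] BalTensor R M Y}
    {d' : Y →ₗ[R] Z} {s' : Y →ₗ[R] BalTensor R M Z} (hd : d' ∘ₗ d = 0)
    (hs : s' ∘ₗ d + lTensor R M d' ∘ₗ s = 0) : θ.twistMap d' s' ∘ₗ θ.twistMap d s = 0 := by
  ext z
  have h1 (x : X) : d' (d x) = 0 := LinearMap.congr_fun hd x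
  have h2 (x : X) : s' (d x) + lTensor R M d' (s x) = 0 := LinearMap.congr_fun hs x
  rw [LinearMap.comp_apply, LinearMap.zero_apply, ext_iff_components, fstMap_twistMap,
    sndMap_twistMap hθ, fstMap_twistMap, sndMap_twistMap hθ, h1, map_add, ← add_assoc, h2,
    ← lTensor_comp_apply, hd, lTensor_zero]
  simp

/-- Triangularity: solve first in the component over R. The relation `hs` makes what is left in M ⊗
Y a cycle for 1 ⊗ d'. -/
theorem twistMap_exact (hθ : θ.toLinearMap = 0) {d : X →ₗ[R] Y} {s : X →ₗ[R] BalTensor R M Y}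
    {d' : Y →ₗ[R] Z} {s' : Y →ₗ[R] BalTensor R M Z} (hd : Function.Exact d d')
    (hM : Function.Exact (lTensor R M d) (lTensor R M d'))
    (hs : s' ∘ₗ d + lTensor R M d' ∘ₗ s = 0) :
    Function.Exact (θ.twistMap d s) (θ.twistMap d' s') := fun z => by
  constructor
  · intro hz
    rw [ext_iff_components, fstMap_twistMap, sndMap_twistMap hθ, map_zero, map_zero] at hz
    obtain ⟨x, hx⟩ := (hd _).1 hz.1
    have h2 : s' (d x) + lTensor R M d' (s x) = 0 := LinearMap.congr_fun hs x
    obtain ⟨w, hw⟩ := (hM (θ.sndMap Y z - s x)).1 (by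
      rw [map_sub, eq_neg_of_add_eq_zero_right hz.2, ← hx, eq_neg_of_add_eq_zero_right h2,
        sub_self])
    refine ⟨tmul R (1 : θ.Ext) x + θ.inrMap X w, ?_⟩
    rw [ext_iff_components, fstMap_twistMap, sndMap_twistMap hθ]
    simp [hx, hw, zero_tmul]
  · rintro ⟨z, rfl⟩
    exact LinearMap.congr_fun (twistMap_comp hθ hd.linearMap_comp_eq_zero hs) z

end Twist

section TwistedComplex

variable {θ} (hθ : θ.toLinearMap = 0) (P : CochainComplex (ModuleCat.{u} R) ℤ)
  (σ : ∀ i j, P.X i →ₗ[R] BalTensor R M (P.X j))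
  (hσ : ∀ i j k, i + 1 = j → j + 1 = k →
    σ j k ∘ₗ (P.d i j).hom + lTensor R M (P.d j k).hom ∘ₗ σ i j = 0)

/-- The complex `T ⊗_R P` with its differential twisted by a cocycle `σ : P → M ⊗_R P[1]`. -/
def twistedComplex : CochainComplex (ModuleCat.{u} θ.Ext) ℤ where
  X i := ModuleCat.of θ.Ext (BalTensor R θ.Ext (P.X i))
  d i j := if i + 1 = j then ModuleCat.ofHom (θ.twistMap (P.d i j).hom (σ i j)) else 0
  shape i j h := if_neg h
  d_comp_d' i j k hij hjk := by
    have h1 : i + 1 = j := hij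
    have h2 : j + 1 = k := hjk
    rw [if_pos h1, if_pos h2]
    exact ModuleCat.hom_ext (twistMap_comp hθ (ModuleCat.hom_ext_iff.1 (P.d_comp_d i j k))
      (hσ i j k h1 h2))

theorem twistedComplex_d {i j : ℤ} (h : i + 1 = j) : (twistedComplex hθ P σ hσ).d i j =
    ModuleCat.ofHom (θ.twistMap (P.d i j).hom (σ i j)) := if_pos h

theorem twistedComplex_acyclic (hP : P.Acyclic) (hM : (tensorComplex R M P).Acyclic) :
    (twistedComplex hθ P σ hσ).Acyclic := by
  rw [acyclic_iff_exact] at *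
  intro i j k hi hk
  rw [twistedComplex_d _ _ _ _ hi, twistedComplex_d _ _ _ _ hk]
  exact twistMap_exact hθ (hP i j k hi hk) (hM i j k hi hk)
    (hσ i j k hi hk)

/-- Maps from the twisted complex to `R`-modules only see the complex `P`. -/
theorem twistedComplex_homAcyclic {N : ModuleCat.{u} R} (hN : HomAcyclic P N) :
    HomAcyclic (twistedComplex hθ P σ hσ) ((ModuleCat.restrictScalars θ.proj).obj N) := by
  rw [homAcyclic_iff] at *
  intro i j k hi hk f hf
  let φ : BalTensor R θ.Ext (P.X j) →ₗ[θ.Ext] ((ModuleCat.restrictScalars θ.proj).obj N) := f.hom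
  let f' : P.X j →ₗ[R] N :=
    { toFun := fun x => φ (tmul R (1 : θ.Ext) x)
      map_add' := fun x y => by rw [tmul_add, map_add]; rfl
      map_smul' := fun r x => by
        rw [← op_smul_tmul, op_smul_ext, one_mul, ← mul_one (θ.incl r), ← smul_eq_mul, ← smul_tmul, map_smul]
        rfl }
  -- M acts as zero on the target, so a T-linear map kills M ⊗ P^j and is determined by the
  -- component over R.
  have hφ (z : BalTensor R θ.Ext (P.X j)) : φ z = f' (θ.fstMap _ z) := by
    have hinr (w : BalTensor R M (P.X j)) : φ (θ.inrMap _ w) = 0 := by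
      induction w using induction_on with
      | zero => rw [map_zero, map_zero]
      | add a b ha hb => rw [map_add, map_add, ha, hb, add_zero]
      | tmul m x =>
        rw [inrMap_tmul, ← mul_one (θ.inr m), ← smul_eq_mul, ← smul_tmul, map_smul]
        exact zero_smul R (f' x)
    conv_lhs => rw [← θ.decompose z, map_add, hinr, add_zero]
    rfl
  rw [twistedComplex_d _ _ _ _ hi] at hf
  obtain ⟨g, hg⟩ := hN i j k hi hk (ModuleCat.ofHom f') (by
    ext x
    have h0 : φ (θ.twistMap (P.d i j).hom (σ i j) (tmul R (1 : θ.Ext) x)) = 0 :=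
      LinearMap.congr_fun (ModuleCat.hom_ext_iff.1 hf) (tmul R (1 : θ.Ext) x)
    rw [hφ, fstMap_twistMap, fstMap_tmul, Ext.one_fst, one_smul] at h0
    exact h0)
  let γ : BalTensor R θ.Ext (P.X k) →ₗ[θ.Ext] ((ModuleCat.restrictScalars θ.proj).obj N) :=
    { toFun := fun z => g.hom (θ.fstMap _ z)
      map_add' := fun z z' => by rw [map_add, map_add]; rfl
      map_smul' := fun t z =>
        (congrArg g.hom (θ.fstMap_smul t z)).trans (map_smul g.hom t.fst _) }
  refine ⟨ModuleCat.ofHom (Y := (ModuleCat.restrictScalars θ.proj).obj N) γ, ?_⟩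
  rw [twistedComplex_d _ _ _ _ hk]
  have hz (z : BalTensor R θ.Ext (P.X j)) :
      g.hom (θ.fstMap _ (θ.twistMap (P.d j k).hom (σ j k) z)) = φ z := by
    rw [fstMap_twistMap, hφ]
    exact LinearMap.congr_fun (ModuleCat.hom_ext_iff.1 hg) _
  exact ModuleCat.hom_ext (LinearMap.ext hz)

/-- If `θ = 0`, then `0 → M → T → R → 0` is a sequence of `T`-modules on which `M` acts by zero at
both ends. -/
theorem homAcyclic_free_of_restrict (hθ : θ.toLinearMap = 0)
    {Q : CochainComplex (ModuleCat.{u} θ.Ext) ℤ}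
    [∀ i, Projective (Q.X i)] (I : Type u)
    (hR : HomAcyclic Q ((ModuleCat.restrictScalars θ.proj).obj (ModuleCat.of R (I →₀ R))))
    (hM : HomAcyclic Q ((ModuleCat.restrictScalars θ.proj).obj (ModuleCat.of R (I →₀ M)))) :
    HomAcyclic Q (ModuleCat.of θ.Ext (I →₀ θ.Ext)) := by
  let f : (ModuleCat.restrictScalars θ.proj).obj (ModuleCat.of R (I →₀ M)) →ₗ[θ.Ext]
      (I →₀ θ.Ext) :=
    { toFun := fun v => Finsupp.mapRange.addMonoidHom θ.inr (v : I →₀ M)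
      map_add' := fun v w => map_add (Finsupp.mapRange.addMonoidHom θ.inr) v w
      map_smul' := fun t v => by
        refine Finsupp.ext fun i => ?_
        change θ.inr (t.fst • DFunLike.coe (F := I →₀ M) v i) =
          t * θ.inr (DFunLike.coe (F := I →₀ M) v i)
        ext <;> simp [hθ] }
  let g : (I →₀ θ.Ext) →ₗ[θ.Ext]
      (ModuleCat.restrictScalars θ.proj).obj (ModuleCat.of R (I →₀ R)) :=
    { toFun := fun v => (Finsupp.mapRange.addMonoidHom θ.proj.toAddMonoidHom v : I →₀ R)
      map_add' := fun v w => map_add (Finsupp.mapRange.addMonoidHom θ.proj.toAddMonoidHom) v w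
      map_smul' := fun t v => Finsupp.ext (M := R) fun i => rfl }
  refine HomAcyclic.of_shortExact_mid (shortExact_mk f g ?_ ?_ ?_) hM hR
  · intro v w h
    refine Finsupp.ext (M := M) fun i => ?_
    exact congrArg Ext.snd (DFunLike.congr_fun h i)
  · intro v
    constructor
    · intro h
      refine ⟨(Finsupp.mapRange.addMonoidHom
        { toFun := Ext.snd, map_zero' := rfl, map_add' := fun _ _ => rfl } v : I →₀ M), ?_⟩
      refine Finsupp.ext fun i => ?_
      have := DFunLike.congr_fun (F := I →₀ R) h i
      exact Ext.ext this.symm rfl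
    · rintro ⟨w, rfl⟩
      exact Finsupp.ext (M := R) fun i => rfl
  · intro v
    exact ⟨Finsupp.mapRange.addMonoidHom θ.incl.toAddMonoidHom (v : I →₀ R),
      Finsupp.ext (M := R) fun i => rfl⟩

/-- The cocycle drops out of both tests: acyclicity follows from the diagonal entries, and maps to
T-modules with trivial M-action, from which free T-modules are built, see only P. -/
theorem twistedComplex_complete (h : θ.BaseAcyclicity) (hP : IsCompleteProjectiveResolution P) :
    IsCompleteProjectiveResolution (twistedComplex hθ P σ hσ) := by
  have hproj (i : ℤ) : Projective ((twistedComplex hθ P σ hσ).X i) :=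
    have := hP.projective i
    tensorFunctor_projective θ.incl (fun _ _ => rfl) (P.X i)
  refine ⟨hproj, twistedComplex_acyclic hθ P σ hσ hP.acyclic (h P hP).1, fun N _ => ?_⟩
  obtain ⟨r⟩ := Projective.retract_finsupp N
  exact (homAcyclic_free_of_restrict hθ N
    (twistedComplex_homAcyclic hθ P σ hσ (hP.homAcyclic_free N))
    (twistedComplex_homAcyclic hθ P σ hσ (h.homAcyclic_finsupp hP N))).of_retract r

end TwistedComplex

end AssocBimoduleHom

/-! ### The converse when θ = 0 -/

namespace AssocBimoduleHom

variable {R : Type u} [Ring R] {M : Type u} [AddCommGroup M] [Module R M] [Module Rᵐᵒᵖ M]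
  [SMulCommClass R Rᵐᵒᵖ M] {θ : AssocBimoduleHom R M}

/-- If `θ = 0`, a `T`-module `(X, α)` is Gorenstein projective as soon as `Coker α` is and the
sequence `M ⊗ M ⊗ X → M ⊗ X → X` is exact: it is presented by a twist of `T ⊗_R P`, for `P` a
complete resolution of `Coker α`. -/
theorem gorenstein_pairModule (h : θ.BaseAcyclicity) (hθ : θ.toLinearMap = 0)
    {X : Type u} [AddCommGroup X] [Module R X] {α : BalTensor R M X →ₗ[R] X} (hα : θ.IsAction α)
    (hG : IsGorensteinProjective (ModuleCat.of R (X ⧸ LinearMap.range α)))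
    (hex : Function.Exact (θ.barMap α) α) : IsGorensteinProjective (θ.pairModule α hα) := by
  obtain ⟨P, hP, p', -, hp, -, -, hdp⟩ := hG.exists_factorization
  have hproj (i : ℤ) : Module.Projective R (P.X i) :=
    (IsProjective.iff_projective _).2 (hP.projective i)
  let p : P.X 0 →ₗ[R] (X ⧸ LinearMap.range α) := p'.hom
  let d : P.X (-1) →ₗ[R] P.X 0 := (P.d (-1) 0).hom
  let d' : P.X (-2) →ₗ[R] P.X (-1) := (P.d (-2) (-1)).hom
  let π : X →ₗ[R] (X ⧸ LinearMap.range α) := (LinearMap.range α).mkQ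
  have hdd' (x : P.X (-2)) : d (d' x) = 0 :=
    LinearMap.congr_fun (ModuleCat.hom_ext_iff.1 (P.d_comp_d (-2) (-1) 0)) x
  have hαπ : Function.Exact α π := fun _ =>
    Submodule.Quotient.mk_eq_zero (LinearMap.range α)
  have hπ : Function.Surjective π := Submodule.mkQ_surjective _
  have hFα : Function.Exact (lTensor R M α) α := by
    rwa [barMap, tensorId_eq_zero hθ, sub_zero] at hex
  have hFπ := lTensor_exact R M hαπ hπ
  have hFp := lTensor_exact R M hdp hp
  -- Both kernels are Im(1 ⊗ α), so α induces an embedding of M ⊗ Coker α into X; this is how the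
  -- exactness assumption is used below.
  have hker (w : BalTensor R M X) : α w = 0 ↔ lTensor R M π w = 0 := (hFα w).trans (hFπ w).symm
  obtain ⟨s, hs⟩ := Module.projective_lifting_property π p hπ
  have hs (x : P.X 0) : π (s x) = p x := LinearMap.congr_fun hs x
  have hFs (w : BalTensor R M (P.X 0)) :
      lTensor R M π (lTensor R M s w) = lTensor R M p w := by
    rw [← lTensor_comp_apply]
    exact congrArg (fun f => lTensor R M f w) (LinearMap.ext hs)
  have hsd (x : P.X (-1)) : s (d x) ∈ LinearMap.range α :=
    (hαπ _).1 (by rw [hs]; exact hdp.apply_apply_eq_zero x)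
  -- The lift s of p need not kill boundaries; s d takes values in Im α, and b measures this defect.
  obtain ⟨b, hb⟩ := Module.projective_lifting_property α.rangeRestrict
    ((s ∘ₗ d).codRestrict _ hsd) α.surjective_rangeRestrict
  have hb (x : P.X (-1)) : α (b x) = s (d x) :=
    congrArg Subtype.val (LinearMap.congr_fun hb x)
  -- The sign makes the off-diagonal entry τ cancel the defect b in `hgd`.
  obtain ⟨τ, hτ⟩ := Module.projective_lifting_property (lTensor R M p) (-(lTensor R M π ∘ₗ b))
    (lTensor_surjective R M hp)
  have hτ (x : P.X (-1)) : lTensor R M p (τ x) = -lTensor R M π (b x) :=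
    LinearMap.congr_fun hτ x
  -- Since α b d' = s d d' = 0, `hker` puts τ d' in the kernel of 1 ⊗ p, which is the image of 1 ⊗
  -- d.
  have hcocycle (x : P.X (-2)) : lTensor R M (P.d 0 1).hom (τ (d' x)) = 0 := by
    have h0 : lTensor R M p (τ (d' x)) = 0 := by
      rw [hτ, (hker _).1 (by rw [hb, hdd', map_zero]), neg_zero]
    obtain ⟨v, hv⟩ := (hFp _).1 h0
    rw [← hv]
    exact ((acyclic_iff_exact _).1 (h P hP).1 (-1) 0 1 (by simp) (by simp)).apply_apply_eq_zero v
  have := hP.projective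
  -- Each M ⊗ P^i is a retract of a direct sum of copies of M, so condition (1) gives the Hom
  -- acyclicity required.
  obtain ⟨σ, hσ0, hσ⟩ := exists_cocycle (P := P) (K := tensorComplex R M P) (h P hP).1
    (fun i => by
      obtain ⟨r⟩ := Projective.retract_finsupp (P.X i)
      exact ((h.homAcyclic_finsupp hP (P.X i)).of_iso (LinearEquiv.toModuleIso
        ((finsuppEquiv R R M (P.X i) R).trans
          (Finsupp.mapRange.linearEquiv (ridEquiv R R M))).symm)).of_retract
            (r.map (tensorFunctor R R M)))
    (ModuleCat.ofHom τ) (ModuleCat.hom_ext (LinearMap.ext hcocycle))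
  let ς (i j : ℤ) : P.X i →ₗ[R] BalTensor R M (P.X j) := (σ i j).hom
  have hς0 : ς (-1) 0 = τ := ModuleCat.hom_ext_iff.1 hσ0
  have hς (i j k : ℤ) (hij : i + 1 = j) (hjk : j + 1 = k) :
      ς j k ∘ₗ (P.d i j).hom + lTensor R M (P.d j k).hom ∘ₗ ς i j = 0 :=
    ModuleCat.hom_ext_iff.1 (hσ i j k hij hjk)
  let _ : Module θ.Ext X := (θ.pairModule α hα).isModule
  have hi : θ.Induces α := induces_pairModule hα
  let g : BalTensor R θ.Ext (P.X 0) →ₗ[θ.Ext] X := hi.mulMap ∘ₗ lTensor θ.Ext θ.Ext s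
  have hg (z : BalTensor R θ.Ext (P.X 0)) :
      g z = s (θ.fstMap _ z) + α (lTensor R M s (θ.sndMap _ z)) := by
    change hi.mulMap (lTensor θ.Ext θ.Ext s z) = _
    rw [hi.mulMap_apply, fstMap_lTensor, sndMap_lTensor]
  -- Correct x by s y so that it lies in Im α, say α u. By `hker`, u may be replaced by an element
  -- of the image of 1 ⊗ s with the same class in M ⊗ Coker α.
  have hsurj : Function.Surjective g := fun x => by
    obtain ⟨y, hy⟩ := hp (π x)
    obtain ⟨u, hu⟩ := (hαπ (x - s y)).1 (by rw [map_sub, hs, sub_eq_zero]; exact hy.symm)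
    obtain ⟨w, hw⟩ := lTensor_surjective R M hp (lTensor R M π u)
    have : α (u - lTensor R M s w) = 0 := by
      rw [hker, map_sub, hFs, sub_eq_zero]
      exact hw.symm
    rw [map_sub, sub_eq_zero] at this
    refine ⟨tmul R (1 : θ.Ext) y + θ.inrMap _ w, ?_⟩
    rw [hg]
    simp [zero_tmul, ← this, hu]
  have hgd (z : BalTensor R θ.Ext (P.X (-1))) : g (θ.twistMap d τ z) = 0 := by
    have h1 : lTensor R M s (lTensor R M d (θ.sndMap _ z)) =
        lTensor R M α (lTensor R M b (θ.sndMap _ z)) := by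
      rw [← lTensor_comp_apply, ← lTensor_comp_apply]
      congr 2
      exact LinearMap.ext fun x => (hb x).symm
    have h2 : α (lTensor R M s (τ (θ.fstMap _ z)) + b (θ.fstMap _ z)) = 0 := by
      rw [hker, map_add, hFs, hτ, neg_add_cancel]
    rw [map_add, hb] at h2
    rw [hg, fstMap_twistMap, sndMap_twistMap hθ, map_add, map_add, h1,
      hFα.apply_apply_eq_zero, add_zero, add_comm, h2]
  have hexact : Function.Exact (θ.twistMap d τ) g := fun z => by
    constructor
    · intro hz
      have hπz : p (θ.fstMap _ z) = 0 := by
        have := congrArg π hz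
        rwa [hg, map_add, hαπ.apply_apply_eq_zero, add_zero, hs, map_zero] at this
      obtain ⟨y, hy⟩ := (hdp _).1 hπz
      have hy : d y = θ.fstMap _ z := hy
      -- Subtracting the twist of 1 ⊗ y clears the component over R; the rest lies in M ⊗ P^0, where
      -- g = 0 means that 1 ⊗ p vanishes.
      have hw : g (z - θ.twistMap d τ (tmul R (1 : θ.Ext) y)) = 0 := by
        rw [map_sub, hz, hgd, sub_zero]
      have hfst : θ.fstMap _ (z - θ.twistMap d τ (tmul R (1 : θ.Ext) y)) = 0 := by
        rw [map_sub, fstMap_twistMap, fstMap_tmul, Ext.one_fst, one_smul, hy, sub_self]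
      have hsnd : θ.sndMap _ (z - θ.twistMap d τ (tmul R (1 : θ.Ext) y)) =
          θ.sndMap _ z - τ y := by
        rw [map_sub, sndMap_twistMap hθ, fstMap_tmul, sndMap_tmul, Ext.one_fst, Ext.one_snd,
          one_smul, zero_tmul, map_zero, add_zero]
      rw [hg, hfst, hsnd, map_zero, zero_add, hker, hFs] at hw
      obtain ⟨v, hv⟩ := (hFp _).1 hw
      have hv : lTensor R M d v = θ.sndMap _ z - τ y := hv
      refine ⟨tmul R (1 : θ.Ext) y + θ.inrMap _ v, ?_⟩
      rw [ext_iff_components, fstMap_twistMap, sndMap_twistMap hθ]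
      simp [hy, hv, zero_tmul]
    · rintro ⟨z, rfl⟩
      exact hgd z
  refine .of_presentation (twistedComplex_complete hθ P ς hς h hP)
    (ModuleCat.ofHom (Y := θ.pairModule α hα) g) hsurj ?_
  rw [twistedComplex_d _ _ _ _ (by simp), hς0]
  exact hexact

end AssocBimoduleHom

end

theorem corollary4p2 {R : Type u} [Ring R] {M : Type u} [AddCommGroup M] [Module R M]
    [Module Rᵐᵒᵖ M] [SMulCommClass R Rᵐᵒᵖ M] (θ : AssocBimoduleHom R M)
    (h1 : θ.BaseAcyclicity) (h2 : θ.ExtAcyclicity ∨ θ.NilpotentAcyclicity) :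
    (∀ Y : ModuleCat.{u} R, IsGorensteinProjective Y → IsGorensteinProjective (θ.l.obj Y)) ∧
    (∀ Z : ModuleCat.{u} θ.Ext, IsGorensteinProjective Z →
      IsGorensteinProjective (θ.q.obj Z)) ∧
    ∀ (X : Type u) [AddCommGroup X] [Module R X] (α : BalTensor R M X →ₗ[R] X)
      (hα : θ.IsAction α),
      (IsGorensteinProjective (θ.pairModule α hα) →
        IsGorensteinProjective (ModuleCat.of R (X ⧸ LinearMap.range α)) ∧
        Function.Exact (BalTensor.lTensor R M α - θ.tensorId X) α) ∧
      (θ.toLinearMap = 0 →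
        IsGorensteinProjective (ModuleCat.of R (X ⧸ LinearMap.range α)) →
        Function.Exact (BalTensor.lTensor R M α - θ.tensorId X) α →
        IsGorensteinProjective (θ.pairModule α hα)) :=
  ⟨fun _ hY => hY.tensorFunctor fun _ => h1.l_complete,
    fun _ hZ => hZ.tensorFunctor fun _ => AssocBimoduleHom.q_complete h2,
    fun _ _ _ _ hα =>
      ⟨fun hG => ⟨AssocBimoduleHom.gorenstein_coker h2 hα hG,
        AssocBimoduleHom.exact_barMap_of_gorenstein h2 hα hG⟩,
      fun hθ hG hex => AssocBimoduleHom.gorenstein_pairModule h1 hθ hα hG hex⟩⟩
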